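/- Let $\mathbb D=\{z\in\mathbb C:|z|<1\}$ and let $f$ be a convex harmonic mapping of $\mathbb D$, that is, a complex-valued harmonic function in $\mathbb D$ that is injective in $\mathbb D$ and whose image $f(\mathbb D)$ is convex. Write $f=h+\overline g$ with $h,g$ analytic in $\mathbb D$. Then the Jacobian $J_f=|h'|^2-|g'|^2$ does not vanish in $\mathbb D$, so that the Schwarzian derivative $S_f$ is defined in $\mathbb D$: if $J_f>0$, then, with $\omega=g'/h'$ and $Sh=(h''/h')'-\frac12(h''/h')^2$, $$S_f=Sh+\frac{\overline\omega}{1-|\omega|^2}\left(\frac{h''}{h'}\,\omega'-\omega''\right)-\frac32\left(\frac{\omega'\,\overline\omega}{1-|\omega|^2}\right)^2,$$ and if $J_f<0$, then $S_f=S_{\overline f}$, where $\overline f=g+\overline h$. Moreover, $$\|S_f\|=\sup_{z\in\mathbb D}|S_f(z)|\,(1-|z|^2)^2\le 6 .$$ -/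

import Mathlib

namespace HarmonicSchwarzian

/-- `f` is a convex harmonic mapping of the unit disk: it is harmonic there, univalent there, and
the image of the unit disk is a convex set. It may be sense-preserving or sense-reversing. -/
structure IsConvexHarmonicMapping (f : ℂ → ℂ) : Prop where
  harmonic : InnerProductSpace.HarmonicOnNhd f (Metric.ball (0 : ℂ) 1)
  univalent : Set.InjOn f (Metric.ball (0 : ℂ) 1)
  convex_image : Convex ℝ (f '' Metric.ball (0 : ℂ) 1)

/-- `f = h + conj g` in the unit disk with `h` and `g` analytic. (For a given harmonic `f` the pair
is unique up to an additive constant, on which nothing below depends.) -/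
structure IsRepresentation (f h g : ℂ → ℂ) : Prop where
  analytic_left : DifferentiableOn ℂ h (Metric.ball (0 : ℂ) 1)
  analytic_right : DifferentiableOn ℂ g (Metric.ball (0 : ℂ) 1)
  eq_add_conj : ∀ z ∈ Metric.ball (0 : ℂ) 1, f z = h z + (starRingEnd ℂ) (g z)

/-- The Jacobian `|h'|² - |g'|²` of `h + conj g`. -/
noncomputable def jacobian (h g : ℂ → ℂ) (z : ℂ) : ℝ :=
  ‖deriv h z‖ ^ 2 - ‖deriv g z‖ ^ 2

/-- The classical pre-Schwarzian derivative `h'' / h'`. -/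
noncomputable def preSchwarzian (h : ℂ → ℂ) (z : ℂ) : ℂ :=
  deriv (deriv h) z / deriv h z

/-- The classical Schwarzian derivative `(Ph)' - (Ph)² / 2`. -/
noncomputable def classicalSchwarzian (h : ℂ → ℂ) (z : ℂ) : ℂ :=
  deriv (preSchwarzian h) z - 1 / 2 * preSchwarzian h z ^ 2

/-- The (second complex) dilatation `ω = g' / h'` of `h + conj g`. -/
noncomputable def dilatation (h g : ℂ → ℂ) (z : ℂ) : ℂ :=
  deriv g z / deriv h z

/-- The Schwarzian derivative of a sense-preserving harmonic mapping `h + conj g`: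
`Sh + ω̄ / (1 - |ω|²) * (h'' / h' * ω' - ω'') - 3/2 * (ω' ω̄ / (1 - |ω|²))²`. -/
noncomputable def sensePreservingSchwarzian (h g : ℂ → ℂ) (z : ℂ) : ℂ :=
  classicalSchwarzian h z
    + (starRingEnd ℂ) (dilatation h g z) / (1 - (‖dilatation h g z‖ : ℂ) ^ 2)
      * (preSchwarzian h z * deriv (dilatation h g) z - deriv (deriv (dilatation h g)) z)
    - 3 / 2 * (deriv (dilatation h g) z * (starRingEnd ℂ) (dilatation h g z)
      / (1 - (‖dilatation h g z‖ : ℂ) ^ 2)) ^ 2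

open Classical in
/-- The Schwarzian derivative of a locally univalent harmonic mapping `f = h + conj g`: where the
Jacobian is negative it is that of the sense-preserving mapping `conj f = g + conj h`. -/
noncomputable def schwarzian (h g : ℂ → ℂ) (z : ℂ) : ℂ :=
  if 0 < jacobian h g z then sensePreservingSchwarzian h g z else sensePreservingSchwarzian g h z

/-- The Schwarzian norm `sup_{|z| < 1} |S_f(z)| (1 - |z|²)²`, as an element of `[0, ∞]`. -/
noncomputable def schwarzianNorm (h g : ℂ → ℂ) : ENNReal :=
  ⨆ z ∈ Metric.ball (0 : ℂ) 1, ENNReal.ofReal (‖schwarzian h g z‖ * (1 - ‖z‖ ^ 2) ^ 2)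

end HarmonicSchwarzian

namespace HarmonicSchwarzian

open Filter Metric Set Topology Complex MeasureTheory

/-! Suppose first that `f` preserves orientation, fix a point z, and put a = -conj ω(z), a constant
of modulus less than 1. In the formula for the harmonic Schwarzian, conj ω enters only
undifferentiated, and its value at z is exactly what turns the formula into the classical Schwarzian
of the analytic function h + a g at z (`sensePreservingSchwarzian_eq`). Convexity of the image makes
h + a g univalent (`injOn_add_mul_of_convex_image`): pull the segment between two image points of
`f` back to the disk; along the resulting path a suitable real linear functional of h + a g strictly
increases. The bound 6 is then the Kraus–Nehari theorem (`norm_classicalSchwarzian_mul_le`).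

Kraus–Nehari reduces by a disk automorphism to the origin, where it says |b| ≤ 1 for a univalent 1/z
+ bz + O(z²) (`norm_deriv_le_one_of_injOn_inv_add`). This is proved by comparing areas: the image of
an annulus r < |z| < ρ lies in an explicit ellipse whose area is known up to o(1) as r → 0, so no
description of the omitted set is needed.

That the Jacobian never vanishes is Lewy's theorem (`jacobian_ne_zero_of_injOn`). At a zero, some
real linear coordinate of `f` is the real part of an analytic function with a critical point, so one
of its level sets contains a tripod. The other coordinate would be continuous and injective on that
tripod, which is impossible. A nonvanishing Jacobian has constant sign, and if it is negative,
conjugating `f` restores the first case. -/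

/-! ### Lewy's theorem -/

/-- A nonvanishing analytic function has a local analytic `n`-th root. -/
theorem exists_analyticAt_pow_eq {w : ℂ → ℂ} {z₀ : ℂ} (hw : AnalyticAt ℂ w z₀) (hw0 : w z₀ ≠ 0)
    {n : ℕ} (hn : n ≠ 0) :
    ∃ r : ℂ → ℂ, AnalyticAt ℂ r z₀ ∧ r z₀ ≠ 0 ∧ ∀ᶠ z in 𝓝 z₀, r z ^ n = w z := by
  obtain ⟨c, hc⟩ := IsAlgClosed.exists_pow_nat_eq (w z₀) (Nat.pos_of_ne_zero hn)
  have hc0 : c ≠ 0 := by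
    rintro rfl
    exact hw0 (by rw [← hc, zero_pow hn])
  have hq : AnalyticAt ℂ (fun z => w z / w z₀) z₀ := hw.div analyticAt_const hw0
  refine ⟨fun z => c * (w z / w z₀) ^ ((n : ℂ)⁻¹), ?_, ?_, ?_⟩
  · refine analyticAt_const.mul (hq.cpow analyticAt_const ?_)
    simp [div_self hw0]
  · simp [div_self hw0, hc0]
  · refine Eventually.of_forall fun z => ?_
    rw [mul_pow, hc, cpow_nat_inv_pow _ hn, mul_div_cancel₀ _ hw0]

/-- Near a critical point, a level set of the real part of an analytic function contains three
disjoint arms issuing from that point. -/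
theorem exists_three_arms {φ : ℂ → ℂ} {z₀ : ℂ} (hφ : AnalyticAt ℂ φ z₀) (hφ' : deriv φ z₀ = 0)
    {U : Set ℂ} (hU : U ∈ 𝓝 z₀) :
    ∃ (σ : ℂ → ℂ) (ε : ℝ), 0 < ε ∧ ContinuousOn σ (closedBall 0 ε) ∧
      InjOn σ (closedBall 0 ε) ∧ MapsTo σ (closedBall 0 ε) U ∧
      ∃ ζ : Fin 3 → ℂ, Function.Injective ζ ∧ (∀ j, ‖ζ j‖ = 1) ∧
        ∀ j, ∀ t ∈ Icc 0 ε, (φ (σ (t * ζ j))).re = (φ z₀).re := by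
  by_cases hconst : ∀ᶠ z in 𝓝 z₀, φ z - φ z₀ = 0
  -- If φ is locally constant, any three directions serve as arms.
  · obtain ⟨ε, hε, hsub⟩ := nhds_basis_closedBall.mem_iff.1 (inter_mem hU hconst)
    have hmaps : MapsTo (fun z => z₀ + z) (closedBall 0 ε) (closedBall z₀ ε) := by
      intro z hz
      simpa using hz
    refine ⟨fun z => z₀ + z, ε, hε, by fun_prop, fun x _ y _ h => add_left_cancel h,
      fun z hz => (hsub (hmaps hz)).1, ![1, I, -1], ?_, ?_, ?_⟩
    · intro i j hij
      fin_cases i <;> fin_cases j <;> simp_all [Complex.ext_iff] <;> norm_num at hij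
    · intro j
      fin_cases j <;> simp
    · intro j t ht
      have hnorm : ‖(![1, I, -1] : Fin 3 → ℂ) j‖ = 1 := by fin_cases j <;> simp
      have hmem : (t : ℂ) * (![1, I, -1] : Fin 3 → ℂ) j ∈ closedBall (0 : ℂ) ε := by
        rw [mem_closedBall_zero_iff, norm_mul, hnorm, mul_one, norm_real, Real.norm_eq_abs,
          abs_of_nonneg ht.1]
        exact ht.2
      have := (hsub (hmaps hmem)).2
      simp only [mem_ofPred_eq, sub_eq_zero] at this
      exact congrArg re this
  · obtain ⟨n, w, hw, hw0, hfac⟩ :=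
      (hφ.sub analyticAt_const).exists_eventuallyEq_pow_smul_nonzero_iff.2 hconst
    have hn0 : n ≠ 0 := by
      rintro rfl
      have := hfac.self_of_nhds
      simp only [sub_self, pow_zero, one_smul] at this
      exact hw0 (this.symm.trans (sub_self _))
    have hn1 : n ≠ 1 := by
      rintro rfl
      have h1 : HasDerivAt (fun z => φ z - φ z₀) (deriv φ z₀) z₀ :=
        hφ.differentiableAt.hasDerivAt.sub_const _
      have h2 : HasDerivAt (fun z => (z - z₀) * w z) (1 * w z₀ + (z₀ - z₀) * deriv w z₀) z₀ :=
        ((hasDerivAt_id z₀).sub_const z₀).mul hw.differentiableAt.hasDerivAt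
      have h3 : (fun z => φ z - φ z₀) =ᶠ[𝓝 z₀] fun z => (z - z₀) * w z := by
        filter_upwards [hfac] with z hz
        simpa using hz
      have := (h2.congr_of_eventuallyEq h3).unique h1
      rw [hφ'] at this
      simp at this
      exact hw0 this
    have hn2 : 2 ≤ n := by omega
    obtain ⟨r, hr, hr0, hrn⟩ := exists_analyticAt_pow_eq hw hw0 hn0
    have hψ : AnalyticAt ℂ (fun z => (z - z₀) * r z) z₀ :=
      (analyticAt_id.sub analyticAt_const).mul hr
    have hψd : HasDerivAt (fun z => (z - z₀) * r z) (r z₀) z₀ := by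
      have := ((hasDerivAt_id' z₀).sub_const z₀).fun_mul hr.differentiableAt.hasDerivAt
      rwa [sub_self, zero_mul, add_zero, one_mul] at this
    have hstrict : HasStrictDerivAt (fun z => (z - z₀) * r z) (r z₀) z₀ := by
      have := hψ.hasStrictDerivAt
      rwa [hψd.deriv] at this
    -- In the local coordinate y = (z - z₀) r(z), the difference φ - φ(z₀) is exactly yⁿ.
    let e := (hstrict.hasStrictFDerivAt_equiv hr0).toOpenPartialHomeomorph
      (fun z => (z - z₀) * r z)
    have he : ∀ z, e z = (z - z₀) * r z := fun z => rfl
    have hsrc : z₀ ∈ e.source :=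
      (hstrict.hasStrictFDerivAt_equiv hr0).mem_toOpenPartialHomeomorph_source
    have he0 : e z₀ = 0 := by simp [he]
    have htgt : (0 : ℂ) ∈ e.target := he0 ▸ e.map_source hsrc
    have hsymm0 : e.symm 0 = z₀ := by rw [← he0, e.left_inv hsrc]
    have hcont : ContinuousAt e.symm 0 := e.continuousAt_symm htgt
    have hev : ∀ᶠ y in 𝓝 (0 : ℂ), y ∈ e.target ∧ e.symm y ∈ U ∧ φ (e.symm y) - φ z₀ = y ^ n := by
      have h1 : ∀ᶠ z in 𝓝 z₀, φ z - φ z₀ = (e z) ^ n := by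
        filter_upwards [hfac, hrn] with z hz hz'
        rw [he, mul_pow, hz', ← smul_eq_mul]
        exact hz
      have hten : Tendsto e.symm (𝓝 0) (𝓝 z₀) := by
        have := hcont.tendsto
        rwa [hsymm0] at this
      filter_upwards [e.open_target.mem_nhds htgt, hten hU, hten.eventually h1] with y h1 h2 h3
      refine ⟨h1, h2, ?_⟩
      rw [h3, e.right_inv h1]
    obtain ⟨ε, hε, hsub⟩ := nhds_basis_closedBall.mem_iff.1 hev
    -- At these angles yⁿ = (-1)ʲ i tⁿ is purely imaginary. For j ≤ 2 they stay below 2π because n ≥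
    -- 2, which is where criticality enters.
    refine ⟨e.symm, ε, hε, e.continuousOn_symm.mono fun y hy => (hsub hy).1,
      e.symm.injOn.mono fun y hy => (hsub hy).1, fun y hy => (hsub hy).2.1,
      fun j => exp (((2 * (j : ℕ) + 1) * Real.pi / (2 * n) : ℝ) * I), ?_, ?_, ?_⟩
    · have hnpos : (0 : ℝ) < n := by positivity
      have hrange : ∀ j : Fin 3,
          (2 * ((j : ℕ) : ℝ) + 1) * Real.pi / (2 * n) ∈ Ico 0 (2 * Real.pi) := by
        intro j
        have hj : ((j : ℕ) : ℝ) ≤ 2 := by exact_mod_cast Nat.lt_succ_iff.1 j.2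
        have hn2' : (2 : ℝ) ≤ n := by exact_mod_cast hn2
        refine ⟨by positivity, ?_⟩
        rw [div_lt_iff₀ (by positivity)]
        nlinarith [Real.pi_pos]
      intro i j hij
      simp only [exp_eq_exp_iff_exists_int] at hij
      obtain ⟨m, hm⟩ := hij
      have hm' : (2 * ((i : ℕ) : ℝ) + 1) * Real.pi / (2 * n) =
          (2 * ((j : ℕ) : ℝ) + 1) * Real.pi / (2 * n) + m * (2 * Real.pi) := by
        have h := congrArg im hm
        simp only [mul_im, ofReal_re, I_im, ofReal_im, I_re, add_im, mul_re, mul_one, mul_zero,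
          add_zero] at h
        simpa using h
      have hmlt : (m : ℝ) < 1 := by
        nlinarith [(hrange i).1, (hrange i).2, (hrange j).1, (hrange j).2, Real.pi_pos]
      have hmgt : (-1 : ℝ) < m := by
        nlinarith [(hrange i).1, (hrange i).2, (hrange j).1, (hrange j).2, Real.pi_pos]
      have hm0 : m = 0 := by
        have h1 : m < 1 := by exact_mod_cast hmlt
        have h2 : -1 < m := by exact_mod_cast hmgt
        omega
      rw [hm0] at hm'
      have hpi := Real.pi_ne_zero
      field_simp at hm'
      have : ((i : ℕ) : ℝ) = (j : ℕ) := by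
        push_cast at hm'
        nlinarith
      exact Fin.ext (by exact_mod_cast this)
    · intro j
      exact norm_exp_ofReal_mul_I _
    · intro j t ht
      have hmem : (t : ℂ) * exp (((2 * (j : ℕ) + 1) * Real.pi / (2 * n) : ℝ) * I) ∈
          closedBall (0 : ℂ) ε := by
        rw [mem_closedBall_zero_iff, norm_mul, norm_exp_ofReal_mul_I, mul_one, norm_real,
          Real.norm_eq_abs, abs_of_nonneg ht.1]
        exact ht.2
      have h := (hsub hmem).2.2
      have hpow : exp (((2 * (j : ℕ) + 1) * Real.pi / (2 * n) : ℝ) * I) ^ n =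
          (-1) ^ (j : ℕ) * I := by
        rw [← exp_nat_mul]
        have hnC : (n : ℂ) ≠ 0 := by exact_mod_cast hn0
        have : (n : ℂ) * ((((2 * (j : ℕ) + 1) * Real.pi / (2 * n) : ℝ) : ℂ) * I) =
            (j : ℕ) * (Real.pi * I) + Real.pi / 2 * I := by
          push_cast
          field_simp
        rw [this, exp_add, exp_nat_mul, exp_pi_mul_I, exp_pi_div_two_mul_I]
      rw [mul_pow, hpow] at h
      have h' := congrArg re h
      rw [sub_re] at h'
      have hz : ((t : ℂ) ^ n * ((-1) ^ (j : ℕ) * I)).re = 0 := by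
        have : (t : ℂ) ^ n * ((-1) ^ (j : ℕ) * I) = ((t ^ n * (-1) ^ (j : ℕ) : ℝ) : ℂ) * I := by
          push_cast
          ring
        rw [this]
        simp only [mul_re, I_re, mul_zero, ofReal_im, zero_mul, sub_self]
      rw [hz] at h'
      linarith

/-- A continuous real function cannot be injective on a union of three arms. -/
theorem not_injective_on_three_arms {v : ℂ → ℝ} {ε : ℝ} (hε : 0 < ε)
    (hv : ContinuousOn v (closedBall 0 ε)) {ζ : Fin 3 → ℂ} (hζ : Function.Injective ζ)
    (hζ1 : ∀ j, ‖ζ j‖ = 1)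
    (hinj : ∀ i j, ∀ s ∈ Icc 0 ε, ∀ t ∈ Icc 0 ε,
      v (s * ζ i) = v (t * ζ j) → (s : ℂ) * ζ i = t * ζ j) : False := by
  have hmem : ∀ j, ∀ t ∈ Icc 0 ε, (t : ℂ) * ζ j ∈ closedBall (0 : ℂ) ε := by
    intro j t ht
    rw [mem_closedBall_zero_iff, norm_mul, hζ1, mul_one, norm_real, Real.norm_eq_abs,
      abs_of_nonneg ht.1]
    exact ht.2
  have hζ0 : ∀ j, ζ j ≠ 0 := fun j h => by simpa [h] using hζ1 j
  have hcont : ∀ j, ContinuousOn (fun t : ℝ => v (t * ζ j)) (Icc 0 ε) := fun j =>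
    hv.comp (by fun_prop) fun t ht => hmem j t ht
  have h0 : (0 : ℝ) ∈ Icc 0 ε := ⟨le_rfl, hε.le⟩
  have hεm : ε ∈ Icc 0 ε := ⟨hε.le, le_rfl⟩
  have hne : ∀ j, v (ε * ζ j) ≠ v 0 := by
    intro j h
    have := hinj j j ε hεm 0 h0 (by simpa using h)
    simp [hζ0 j, hε.ne'] at this
  -- a value taken on two arms away from the common endpoint
  have key : ∀ i j c, i ≠ j → c ≠ v 0 → c ∈ uIcc (v 0) (v (ε * ζ i)) →
      c ∈ uIcc (v 0) (v (ε * ζ j)) → False := by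
    intro i j c hij hc hi hj
    have hiv : ∀ k, c ∈ uIcc (v 0) (v (ε * ζ k)) → ∃ t ∈ Icc 0 ε, v (t * ζ k) = c := by
      intro k hk
      have := intermediate_value_uIcc (a := 0) (b := ε) (f := fun t : ℝ => v (t * ζ k))
        (by rw [uIcc_of_le hε.le]; exact hcont k)
      simp only [ofReal_zero, zero_mul] at this
      obtain ⟨t, ht, htc⟩ := this hk
      exact ⟨t, by rwa [uIcc_of_le hε.le] at ht, htc⟩
    obtain ⟨s, hs, hsc⟩ := hiv i hi
    obtain ⟨t, ht, htc⟩ := hiv j hj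
    have heq := hinj i j s hs t ht (hsc.trans htc.symm)
    have hst : s = t := by
      have := congrArg norm heq
      simpa [hζ1, abs_of_nonneg hs.1, abs_of_nonneg ht.1] using this
    have hs0 : (s : ℂ) ≠ 0 := by
      intro h
      rw [h, zero_mul] at hsc
      exact hc hsc.symm
    rw [← hst] at heq
    exact hij (hζ (mul_left_cancel₀ hs0 heq))
  -- Along each arm v moves either above or below v(0). Two arms going the same way share a value
  -- other than v(0), and three arms have only two ways to go.
  have hsame : ∀ i j, i ≠ j → ¬ (v 0 < v (ε * ζ i) ↔ v 0 < v (ε * ζ j)) := by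
    intro i j hij h
    rcases lt_or_gt_of_ne (hne i) with hi | hi
    · have hj : v (ε * ζ j) < v 0 :=
        lt_of_le_of_ne (not_lt.1 fun hj => (lt_asymm hi (h.2 hj))) (hne j)
      refine key i j (max (v (ε * ζ i)) (v (ε * ζ j))) hij (max_lt hi hj).ne ?_ ?_
      · rw [mem_uIcc]
        exact Or.inr ⟨le_max_left _ _, (max_lt hi hj).le⟩
      · rw [mem_uIcc]
        exact Or.inr ⟨le_max_right _ _, (max_lt hi hj).le⟩
    · have hj := h.1 hi
      refine key i j (min (v (ε * ζ i)) (v (ε * ζ j))) hij (lt_min hi hj).ne' ?_ ?_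
      · rw [mem_uIcc]
        exact Or.inl ⟨(lt_min hi hj).le, min_le_left _ _⟩
      · rw [mem_uIcc]
        exact Or.inl ⟨(lt_min hi hj).le, min_le_right _ _⟩
  have h01 := hsame 0 1 (by decide)
  have h02 := hsame 0 2 (by decide)
  have h12 := hsame 1 2 (by decide)
  tauto

/-- Lewy's theorem: the Jacobian of an injective harmonic mapping does not vanish. -/
theorem jacobian_ne_zero_of_injOn {h g : ℂ → ℂ} {U : Set ℂ} (hU : IsOpen U)
    (hh : DifferentiableOn ℂ h U) (hg : DifferentiableOn ℂ g U)
    (hinj : InjOn (fun z => h z + (starRingEnd ℂ) (g z)) U) {z₀ : ℂ} (hz₀ : z₀ ∈ U) :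
    jacobian h g z₀ ≠ 0 := by
  intro hJ
  have hUn := hU.mem_nhds hz₀
  have hnorm : ‖deriv h z₀‖ = ‖deriv g z₀‖ := by
    unfold jacobian at hJ
    exact (sq_eq_sq₀ (norm_nonneg _) (norm_nonneg _)).1 (sub_eq_zero.1 hJ)
  -- Re(l f) is the real part of the analytic function l h + conj(l) g. Taking l² = -g'/h' makes the
  -- point critical for it; this l is unimodular since |g'| = |h'| there.
  obtain ⟨l, hl, hlz⟩ : ∃ l : ℂ, ‖l‖ = 1 ∧
      l * deriv h z₀ + (starRingEnd ℂ) l * deriv g z₀ = 0 := by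
    by_cases h0 : deriv h z₀ = 0
    · have : deriv g z₀ = 0 := by rwa [h0, norm_zero, eq_comm, norm_eq_zero] at hnorm
      exact ⟨1, by simp, by simp [h0, this]⟩
    · obtain ⟨l, hl⟩ := IsAlgClosed.exists_pow_nat_eq (-(deriv g z₀ / deriv h z₀)) two_pos
      have hl1 : ‖l‖ = 1 := by
        have := congrArg norm hl
        rw [norm_pow, norm_neg, norm_div, ← hnorm, div_self (norm_ne_zero_iff.2 h0)] at this
        exact (pow_eq_one_iff_of_nonneg (norm_nonneg _) two_ne_zero).1 this
      refine ⟨l, hl1, ?_⟩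
      have hll : (starRingEnd ℂ) l * l = 1 := by
        rw [mul_comm, mul_conj, normSq_eq_norm_sq, hl1]
        simp
      have hgh : deriv g z₀ = - l ^ 2 * deriv h z₀ := by
        rw [hl]
        field_simp
      rw [hgh]
      linear_combination (-l * deriv h z₀) * hll
  have hhA : AnalyticAt ℂ h z₀ := hh.analyticAt hUn
  have hgA : AnalyticAt ℂ g z₀ := hg.analyticAt hUn
  have hφ : AnalyticAt ℂ (fun z => l * h z + (starRingEnd ℂ) l * g z) z₀ :=
    (analyticAt_const.mul hhA).add (analyticAt_const.mul hgA)
  have hφ' : deriv (fun z => l * h z + (starRingEnd ℂ) l * g z) z₀ = 0 := by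
    rw [← hlz]
    exact ((hhA.differentiableAt.hasDerivAt.const_mul l).add
      (hgA.differentiableAt.hasDerivAt.const_mul _)).deriv
  obtain ⟨σ, ε, hε, hσc, hσi, hσm, ζ, hζ, hζ1, hlev⟩ := exists_three_arms hφ hφ' hUn
  have hl0 : l ≠ 0 := fun h => by simp [h] at hl
  have hre : ∀ z, (l * (h z + (starRingEnd ℂ) (g z))).re =
      (l * h z + (starRingEnd ℂ) l * g z).re := by
    intro z
    simp only [mul_re, add_re, add_im, conj_re, conj_im]
    ring
  have hmem : ∀ j, ∀ t ∈ Icc 0 ε, (t : ℂ) * ζ j ∈ closedBall (0 : ℂ) ε := by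
    intro j t ht
    rw [mem_closedBall_zero_iff, norm_mul, hζ1, mul_one, norm_real, Real.norm_eq_abs,
      abs_of_nonneg ht.1]
    exact ht.2
  refine not_injective_on_three_arms (v := fun y => (l * (h (σ y) + (starRingEnd ℂ) (g (σ y)))).im)
    hε ?_ hζ hζ1 ?_
  · have h1 : ContinuousOn (fun y => h (σ y)) (closedBall 0 ε) := hh.continuousOn.comp hσc hσm
    have h2 : ContinuousOn (fun y => g (σ y)) (closedBall 0 ε) := hg.continuousOn.comp hσc hσm
    exact continuous_im.comp_continuousOn
      (continuousOn_const.mul (h1.add (continuous_conj.comp_continuousOn h2)))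
  · intro i j s hs t ht hst
    refine hσi (hmem i s hs) (hmem j t ht) (hinj (hσm (hmem i s hs)) (hσm (hmem j t ht)) ?_)
    refine mul_left_cancel₀ hl0 (Complex.ext ?_ hst)
    rw [hre, hre, hlev i s hs, hlev j t ht]

/-! ### Convex images and univalence of h + a g -/

/-- With X = A + aB and Y = conj(a) A + B, the product is |X|² + XY, and |X|² - |Y|² = (1 -
|a|²)(|A|² - |B|²) > 0, so |X|² dominates. In the application A = h'd and B = g'd, where d is the
velocity of a path that `f` maps onto a segment. -/
theorem re_mul_conj_pos {A B a : ℂ} (hBA : ‖B‖ < ‖A‖) (ha : ‖a‖ < 1) :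
    0 < ((A + a * B) * (starRingEnd ℂ) ((A + (starRingEnd ℂ) B) +
      a * (starRingEnd ℂ) (A + (starRingEnd ℂ) B))).re := by
  set X := A + a * B with hX
  set Y := (starRingEnd ℂ) a * A + B with hY
  have hval : X * (starRingEnd ℂ) ((A + (starRingEnd ℂ) B) +
      a * (starRingEnd ℂ) (A + (starRingEnd ℂ) B)) = (normSq X : ℂ) + X * Y := by
    rw [← mul_conj, hX, hY]
    simp only [map_add, map_mul, conj_conj]
    ring
  have hdiff : normSq X - normSq Y = (1 - normSq a) * (normSq A - normSq B) := by
    rw [hX, hY]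
    simp only [normSq_apply, add_re, add_im, mul_re, mul_im, conj_re, conj_im]
    ring
  have hpos : 0 < normSq X - normSq Y := by
    rw [hdiff]
    simp only [normSq_eq_norm_sq]
    have h1 : ‖a‖ ^ 2 < 1 := by nlinarith [norm_nonneg a]
    have h2 : ‖B‖ ^ 2 < ‖A‖ ^ 2 := by nlinarith [norm_nonneg B]
    exact mul_pos (by linarith) (by linarith)
  have hXY : ‖Y‖ < ‖X‖ := by
    rw [normSq_eq_norm_sq, normSq_eq_norm_sq, sub_pos] at hpos
    exact lt_of_pow_lt_pow_left₀ 2 (norm_nonneg _) hpos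
  have hre : -(‖X‖ * ‖Y‖) ≤ (X * Y).re := by
    rw [← norm_mul]
    exact (abs_le.1 (abs_re_le_norm _)).1
  rw [hval, add_re, ofReal_re, normSq_eq_norm_sq]
  nlinarith [norm_nonneg Y]

/-- Where the Jacobian is positive, the differential of `h + conj g` is invertible. -/
theorem exists_equiv_hasStrictFDerivAt {h g : ℂ → ℂ} {z : ℂ} (hh : AnalyticAt ℂ h z)
    (hg : AnalyticAt ℂ g z) (hJ : ‖deriv g z‖ < ‖deriv h z‖) :
    ∃ L : ℂ ≃L[ℝ] ℂ, (∀ d, L d = deriv h z * d + (starRingEnd ℂ) (deriv g z * d)) ∧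
      HasStrictFDerivAt (fun z => h z + (starRingEnd ℂ) (g z)) (L : ℂ →L[ℝ] ℂ) z := by
  have hh' : HasStrictFDerivAt h
      ((ContinuousLinearMap.toSpanSingleton ℂ (deriv h z)).restrictScalars ℝ) z :=
    hh.hasStrictDerivAt.hasStrictFDerivAt.restrictScalars ℝ
  have hg' : HasStrictFDerivAt g
      ((ContinuousLinearMap.toSpanSingleton ℂ (deriv g z)).restrictScalars ℝ) z :=
    hg.hasStrictDerivAt.hasStrictFDerivAt.restrictScalars ℝ
  have hg'' : HasStrictFDerivAt (fun z => (starRingEnd ℂ) (g z))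
      ((conjCLE : ℂ →L[ℝ] ℂ).comp
        ((ContinuousLinearMap.toSpanSingleton ℂ (deriv g z)).restrictScalars ℝ)) z :=
    (conjCLE : ℂ →L[ℝ] ℂ).hasStrictFDerivAt.comp z hg'
  have hf := hh'.add hg''
  set L₀ : ℂ →L[ℝ] ℂ := (ContinuousLinearMap.toSpanSingleton ℂ (deriv h z)).restrictScalars ℝ +
    (conjCLE : ℂ →L[ℝ] ℂ).comp
        ((ContinuousLinearMap.toSpanSingleton ℂ (deriv g z)).restrictScalars ℝ) with hL₀
  have hL₀a : ∀ d, L₀ d = deriv h z * d + (starRingEnd ℂ) (deriv g z * d) := by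
    intro d
    simp [hL₀, mul_comm]
  have hker : LinearMap.ker (L₀ : ℂ →ₗ[ℝ] ℂ) = ⊥ := by
    rw [LinearMap.ker_eq_bot']
    intro d hd
    by_contra hd0
    have h1 : deriv h z * d + (starRingEnd ℂ) (deriv g z * d) = 0 := (hL₀a d).symm.trans hd
    have h2 := congrArg norm (eq_neg_of_add_eq_zero_left h1)
    rw [norm_neg, norm_mul, RCLike.norm_conj, norm_mul] at h2
    exact hJ.ne' (mul_right_cancel₀ (norm_ne_zero_iff.2 hd0) h2)
  refine ⟨(LinearEquiv.ofInjectiveEndo (L₀ : ℂ →ₗ[ℝ] ℂ)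
    (LinearMap.ker_eq_bot.1 hker)).toContinuousLinearEquiv, fun d => hL₀a d, ?_⟩
  have hcoe : ((LinearEquiv.ofInjectiveEndo (L₀ : ℂ →ₗ[ℝ] ℂ)
      (LinearMap.ker_eq_bot.1 hker)).toContinuousLinearEquiv : ℂ →L[ℝ] ℂ) = L₀ :=
    ContinuousLinearMap.ext fun _ => rfl
  rw [hcoe]
  exact hf

/-- If `h + conj g` is a sense-preserving harmonic mapping with convex image, then `h + a g` is
injective for every `a` in the unit disk. -/
theorem injOn_add_mul_of_convex_image {h g : ℂ → ℂ} {U : Set ℂ} (hU : IsOpen U)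
    (hh : DifferentiableOn ℂ h U) (hg : DifferentiableOn ℂ g U)
    (hinj : InjOn (fun z => h z + (starRingEnd ℂ) (g z)) U)
    (hconv : Convex ℝ ((fun z => h z + (starRingEnd ℂ) (g z)) '' U))
    (hJ : ∀ z ∈ U, ‖deriv g z‖ < ‖deriv h z‖) {a : ℂ} (ha : ‖a‖ < 1) :
    InjOn (fun z => h z + a * g z) U := by
  intro z₁ hz₁ z₂ hz₂ heq
  by_contra hne
  set f : ℂ → ℂ := fun z => h z + (starRingEnd ℂ) (g z) with hf
  set c : ℂ := f z₂ - f z₁ with hc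
  let k : ℂ → ℂ := Function.invFunOn f U
  have hkU : ∀ w ∈ f '' U, k w ∈ U := fun w hw => Function.invFunOn_mem hw
  have hfk : ∀ w ∈ f '' U, f (k w) = w := fun w hw => Function.invFunOn_eq hw
  have hkf : ∀ z ∈ U, k (f z) = z := fun z hz =>
    hinj (hkU _ (mem_image_of_mem f hz)) hz (hfk _ (mem_image_of_mem f hz))
  let γ : ℝ → ℂ := fun t => f z₁ + t * c
  have hγ : ∀ t ∈ Icc (0 : ℝ) 1, γ t ∈ f '' U := by
    intro t ht
    have := hconv.add_smul_sub_mem (mem_image_of_mem f hz₁) (mem_image_of_mem f hz₂) ht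
    simpa [γ, hc] using this
  have hder : ∀ t ∈ Icc (0 : ℝ) 1, ∃ d : ℂ,
      HasDerivAt (fun s => k (γ s)) d t ∧
        deriv h (k (γ t)) * d + (starRingEnd ℂ) (deriv g (k (γ t)) * d) = c := by
    intro t ht
    set z := k (γ t) with hz
    have hzU : z ∈ U := hkU _ (hγ t ht)
    have hfz : f z = γ t := hfk _ (hγ t ht)
    have hUn := hU.mem_nhds hzU
    obtain ⟨L, hL, hfL⟩ := exists_equiv_hasStrictFDerivAt (hh.analyticAt hUn)
      (hg.analyticAt hUn) (hJ z hzU)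
    have hloc := hfL.to_localInverse.hasFDerivAt
    -- The local inverse takes values in U near f(z), and there injectivity identifies it with the
    -- global inverse; continuity of k need not be known beforehand.
    have hev : k =ᶠ[𝓝 (f z)] hfL.localInverse f L z := by
      filter_upwards [hfL.eventually_right_inverse, hfL.localInverse_tendsto hUn] with y hy hyU
      conv_lhs => rw [← hy]
      exact hkf _ hyU
    have hk : HasFDerivAt k (L.symm : ℂ →L[ℝ] ℂ) (γ t) := by
      rw [← hfz]
      exact hloc.congr_of_eventuallyEq hev
    have hγd : HasDerivAt γ c t := by
      have := ((hasDerivAt_id t).ofReal_comp.mul_const c).const_add (f z₁)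
      simpa [γ] using this
    refine ⟨L.symm c, hk.comp_hasDerivAt t hγd, ?_⟩
    rw [← hL, L.apply_symm_apply]
  have hc0 : c ≠ 0 := fun h0 => hne (hinj hz₂ hz₁ (sub_eq_zero.1 h0)).symm
  -- The direction c + a conj(c) is constant along the segment, so one fixed functional works at
  -- every t.
  let m : ℂ := (starRingEnd ℂ) (c + a * (starRingEnd ℂ) c)
  let u : ℝ → ℝ := fun t => ((h (k (γ t)) + a * g (k (γ t))) * m).re
  have hu : ∀ t ∈ Icc (0 : ℝ) 1, ∃ u', HasDerivAt u u' t ∧ 0 < u' := by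
    intro t ht
    obtain ⟨d, hd, hdc⟩ := hder t ht
    have hzU : k (γ t) ∈ U := hkU _ (hγ t ht)
    have hUn := hU.mem_nhds hzU
    have h1 := (hh.differentiableAt hUn).hasDerivAt.comp t hd
    have h2 := (hg.differentiableAt hUn).hasDerivAt.comp t hd
    have h3 := ((h1.add (h2.const_mul a)).mul_const m)
    refine ⟨_, (reCLM.hasFDerivAt.comp_hasDerivAt t h3), ?_⟩
    have hd0 : d ≠ 0 := by
      rintro rfl
      simp at hdc
      exact hc0 hdc.symm
    have hlt : ‖deriv g (k (γ t)) * d‖ < ‖deriv h (k (γ t)) * d‖ := by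
      rw [norm_mul, norm_mul]
      exact mul_lt_mul_of_pos_right (hJ _ hzU) (norm_pos_iff.2 hd0)
    have := re_mul_conj_pos hlt ha
    rw [hdc] at this
    exact this
  have hmono : StrictMonoOn u (Icc 0 1) := by
    refine strictMonoOn_of_deriv_pos (convex_Icc 0 1) ?_ ?_
    · intro t ht
      obtain ⟨u', hu', -⟩ := hu t ht
      exact hu'.continuousAt.continuousWithinAt
    · intro t ht
      rw [interior_Icc] at ht
      obtain ⟨u', hu', hpos⟩ := hu t ⟨ht.1.le, ht.2.le⟩
      rwa [hu'.deriv]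
  have hlt := hmono (left_mem_Icc.2 zero_le_one) (right_mem_Icc.2 zero_le_one) zero_lt_one
  have hk0 : k (γ 0) = z₁ := by simpa [γ] using hkf z₁ hz₁
  have hk1 : k (γ 1) = z₂ := by simpa [γ, hc] using hkf z₂ hz₂
  simp only [u, hk0, hk1] at hlt
  have heq' : h z₁ + a * g z₁ = h z₂ + a * g z₂ := heq
  rw [heq'] at hlt
  exact lt_irrefl _ hlt

/-! ### The area theorem -/

/-- The determinant of the real-linear map `d ↦ α d + β conj d`. -/
theorem det_mul_add_mul_conj (α β : ℂ) (L : ℂ →ₗ[ℝ] ℂ)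
    (hL : ∀ d, L d = α * d + β * (starRingEnd ℂ) d) :
    LinearMap.det L = ‖α‖ ^ 2 - ‖β‖ ^ 2 := by
  rw [← LinearMap.det_toMatrix basisOneI, Matrix.det_fin_two]
  simp only [LinearMap.toMatrix_apply, hL, coe_basisOneI, coe_basisOneI_repr, Matrix.cons_val_zero,
    Matrix.cons_val_one, ← normSq_eq_norm_sq, normSq_apply, map_one, conj_I, add_re, add_im, mul_re,
    mul_im, one_re, one_im, I_re, I_im, neg_re, neg_im]
  ring

/-- A lower bound for `|k'|²`, `k' = -z⁻² + q`, whose last term averages to zero on circles. -/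
theorem le_norm_sq_neg_inv_sq_add {z : ℂ} (hz : z ≠ 0) (q b : ℂ) :
    1 / ‖z‖ ^ 4 + ‖b‖ ^ 2 + (-2 * b * z ^ 2 / ‖z‖ ^ 4 +
      2 * (-z ^ 2 / ‖z‖ ^ 4 + (starRingEnd ℂ) b) * (q - b)).re ≤ ‖-(z ^ 2)⁻¹ + q‖ ^ 2 := by
  -- On a circle |z| = t this conjugate agrees with the polynomial -z²/t⁴, so the cross terms become
  -- real parts of analytic functions. The only term discarded is |q - b|².
  have hconj : (starRingEnd ℂ) (-(z ^ 2)⁻¹) = -z ^ 2 / ‖z‖ ^ 4 := by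
    have hzc : (starRingEnd ℂ) z ≠ 0 := (map_ne_zero _).2 hz
    have h4 : ((‖z‖ : ℂ)) ^ 4 = z ^ 2 * (starRingEnd ℂ) z ^ 2 := by
      rw [← mul_pow, mul_conj, normSq_eq_norm_sq]
      push_cast
      ring
    rw [h4]
    simp only [map_neg, map_inv₀, map_pow]
    field_simp
  have hnorm : ‖-(z ^ 2)⁻¹‖ ^ 2 = 1 / ‖z‖ ^ 4 := by
    rw [norm_neg, norm_inv, norm_pow]
    field_simp
  have hexp : ∀ x y : ℂ, ‖x + y‖ ^ 2 = ‖x‖ ^ 2 + ‖y‖ ^ 2 + 2 * ((starRingEnd ℂ) x * y).re := by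
    intro x y
    simp only [← normSq_eq_norm_sq, normSq_apply, add_re, add_im, mul_re, conj_re, conj_im]
    ring
  have h1 : ‖-(z ^ 2)⁻¹ + q‖ ^ 2 = ‖(-(z ^ 2)⁻¹ + b) + (q - b)‖ ^ 2 := by ring_nf
  rw [h1, hexp, hexp, hnorm, map_add, hconj]
  have h2 : (-2 * b * z ^ 2 / ‖z‖ ^ 4 +
      2 * (-z ^ 2 / ‖z‖ ^ 4 + (starRingEnd ℂ) b) * (q - b)).re =
      2 * (-z ^ 2 / ‖z‖ ^ 4 * b).re +
        2 * ((-z ^ 2 / ‖z‖ ^ 4 + (starRingEnd ℂ) b) * (q - b)).re := by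
    rw [← re_ofReal_mul, ← re_ofReal_mul, ← add_re]
    congr 1
    push_cast
    ring
  rw [h2]
  nlinarith [sq_nonneg ‖q - b‖]

theorem integral_circleMap_eq {φ : ℂ → ℂ} {t : ℝ} (ht : 0 < t)
    (hφ : DifferentiableOn ℂ φ (closedBall 0 t)) :
    ∫ θ in (-Real.pi)..Real.pi, φ (circleMap 0 t θ) = 2 * Real.pi * φ 0 := by
  have hd : DiffContOnCl ℂ φ (ball 0 |t|) := by
    rw [abs_of_pos ht]
    exact hφ.diffContOnCl_ball le_rfl
  have h := hd.circleAverage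
  rw [Real.circleAverage_def] at h
  have hper : Function.Periodic (fun θ => φ (circleMap 0 t θ)) (2 * Real.pi) := fun θ => by
    simp only [periodic_circleMap 0 t θ]
  have h2 := hper.intervalIntegral_add_eq (-Real.pi) 0
  rw [show -Real.pi + 2 * Real.pi = Real.pi by ring, zero_add] at h2
  rw [h2, ← h, real_smul]
  have := Real.pi_ne_zero
  push_cast
  field_simp

/-- The integral mean of `|k'|²` over a circle, for `k' = -z⁻² + q`. -/
theorem le_integral_norm_sq_circle {q : ℂ → ℂ} (hq : DifferentiableOn ℂ q (ball 0 1)) {t : ℝ}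
    (ht : 0 < t) (ht1 : t < 1) :
    2 * Real.pi * (1 / t ^ 4 + ‖q 0‖ ^ 2) ≤
      ∫ θ in (-Real.pi)..Real.pi, ‖-(circleMap 0 t θ ^ 2)⁻¹ + q (circleMap 0 t θ)‖ ^ 2 := by
  set b := q 0
  -- With |z| frozen at t, this is analytic on the closed disk and vanishes at 0, so the mean value
  -- property kills its integral.
  let A : ℂ → ℂ := fun z => -2 * b * z ^ 2 / t ^ 4 +
      2 * (-z ^ 2 / t ^ 4 + (starRingEnd ℂ) b) * (q z - b)
  have hsub : closedBall (0 : ℂ) t ⊆ ball 0 1 := closedBall_subset_ball ht1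
  have hq' := hq.mono hsub
  have hA : DifferentiableOn ℂ A (closedBall 0 t) := by
    have : (t : ℂ) ^ 4 ≠ 0 := pow_ne_zero _ (ofReal_ne_zero.2 ht.ne')
    fun_prop
  have hA0 : A 0 = 0 := by simp [A, b]
  have hmemc : ∀ θ, circleMap 0 t θ ∈ closedBall (0 : ℂ) t := fun θ =>
    circleMap_mem_closedBall 0 ht.le θ
  have hAc : Continuous fun θ => A (circleMap 0 t θ) :=
    hA.continuousOn.comp_continuous (continuous_circleMap 0 t) hmemc
  have hqc : Continuous fun θ => q (circleMap 0 t θ) :=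
    hq'.continuousOn.comp_continuous (continuous_circleMap 0 t) hmemc
  have hne : ∀ θ, circleMap 0 t θ ≠ 0 := fun θ => circleMap_ne_center ht.ne'
  have hint := integral_circleMap_eq ht hA
  rw [hA0, mul_zero] at hint
  have hre : ∫ θ in (-Real.pi)..Real.pi, (A (circleMap 0 t θ)).re = 0 := by
    have := reCLM.intervalIntegral_comp_comm (hAc.intervalIntegrable (-Real.pi) Real.pi)
      (μ := volume)
    rw [hint] at this
    simpa using this
  have hlow : ∫ θ in (-Real.pi)..Real.pi, (1 / t ^ 4 + ‖b‖ ^ 2 + (A (circleMap 0 t θ)).re) =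
      2 * Real.pi * (1 / t ^ 4 + ‖b‖ ^ 2) := by
    have hreI : IntervalIntegrable (fun θ => (A (circleMap 0 t θ)).re) volume (-Real.pi)
        Real.pi := (continuous_re.comp hAc).intervalIntegrable _ _
    rw [intervalIntegral.integral_add intervalIntegrable_const hreI,
      hre, intervalIntegral.integral_const, smul_eq_mul]
    ring
  rw [← hlow]
  refine intervalIntegral.integral_mono_on (by linarith [Real.pi_pos]) ?_ ?_ ?_
  · exact (continuous_const.add (continuous_re.comp hAc)).intervalIntegrable _ _
  · refine Continuous.intervalIntegrable ?_ _ _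
    have := continuous_circleMap 0 t
    exact (((this.pow 2).inv₀ fun θ => pow_ne_zero _ (hne θ)).neg.add hqc).norm.pow 2
  · intro θ _
    have hn : ‖circleMap 0 t θ‖ = t := by simp [abs_of_pos ht]
    have := le_norm_sq_neg_inv_sq_add (hne θ) (q (circleMap 0 t θ)) b
    rw [hn] at this
    exact this

/-- A lower bound for the area integral of `|k'|²` over an annulus, for `k' = -z⁻² + q`. -/
theorem le_lintegral_annulus {q : ℂ → ℂ} (hqm : Measurable q)
    (hq : DifferentiableOn ℂ q (ball 0 1)) {r ρ : ℝ} (hr : 0 < r) (hrρ : r < ρ) (hρ : ρ < 1) :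
    ENNReal.ofReal (Real.pi * (1 / r ^ 2 - 1 / ρ ^ 2 + ‖q 0‖ ^ 2 * (ρ ^ 2 - r ^ 2))) ≤
      ∫⁻ z in {z : ℂ | r < ‖z‖ ∧ ‖z‖ < ρ}, ENNReal.ofReal (‖-(z ^ 2)⁻¹ + q z‖ ^ 2) := by
  set b := ‖q 0‖ with hb
  have hmeasS : MeasurableSet {z : ℂ | r < ‖z‖ ∧ ‖z‖ < ρ} :=
    ((isOpen_lt continuous_const continuous_norm).inter
      (isOpen_lt continuous_norm continuous_const)).measurableSet
  have hmeas : Measurable fun z : ℂ => ENNReal.ofReal (‖-(z ^ 2)⁻¹ + q z‖ ^ 2) := by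
    fun_prop
  rw [← lintegral_indicator hmeasS, ← Complex.lintegral_comp_polarCoord_symm]
  set G : ℂ → ENNReal := {z : ℂ | r < ‖z‖ ∧ ‖z‖ < ρ}.indicator
    fun z => ENNReal.ofReal (‖-(z ^ 2)⁻¹ + q z‖ ^ 2) with hG
  have hGm : Measurable G := hmeas.indicator hmeasS
  have hsymm : Measurable fun p : ℝ × ℝ => Complex.polarCoord.symm p := by
    have : (fun p : ℝ × ℝ => Complex.polarCoord.symm p) =
        fun p : ℝ × ℝ => (p.1 : ℂ) * (Real.cos p.2 + Real.sin p.2 * I) := by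
      ext p
      exact Complex.polarCoord_symm_apply p
    rw [this]
    fun_prop
  have hFm : Measurable fun p : ℝ × ℝ => ENNReal.ofReal p.1 • G (Complex.polarCoord.symm p) :=
    (ENNReal.measurable_ofReal.comp measurable_fst).smul (hGm.comp hsymm)
  rw [polarCoord_target, Measure.volume_eq_prod, ← Measure.prod_restrict,
    lintegral_prod _ hFm.aemeasurable]
  have hinner : ∀ t ∈ Ioo r ρ, ENNReal.ofReal (2 * Real.pi * (1 / t ^ 3 + b ^ 2 * t)) ≤
      ∫⁻ θ in Ioo (-Real.pi) Real.pi, ENNReal.ofReal t • G (Complex.polarCoord.symm (t, θ)) := by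
    intro t ht
    have ht0 : 0 < t := hr.trans ht.1
    have hcm : ∀ θ, Complex.polarCoord.symm (t, θ) = circleMap 0 t θ := by
      intro θ
      rw [Complex.polarCoord_symm_apply, circleMap_zero, exp_mul_I]
      simp
    have hmem : ∀ θ, circleMap 0 t θ ∈ {z : ℂ | r < ‖z‖ ∧ ‖z‖ < ρ} := by
      intro θ
      simpa [abs_of_pos ht0] using ht
    have hval : ∀ θ, ENNReal.ofReal t • G (Complex.polarCoord.symm (t, θ)) =
        ENNReal.ofReal (t * ‖-(circleMap 0 t θ ^ 2)⁻¹ + q (circleMap 0 t θ)‖ ^ 2) := by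
      intro θ
      rw [hcm, hG, indicator_of_mem (hmem θ), smul_eq_mul, ENNReal.ofReal_mul ht0.le]
    simp only [hval]
    have hcont : Continuous fun θ =>
        t * ‖-(circleMap 0 t θ ^ 2)⁻¹ + q (circleMap 0 t θ)‖ ^ 2 := by
      have h1 := continuous_circleMap 0 t
      have hqc : Continuous fun θ => q (circleMap 0 t θ) :=
        hq.continuousOn.comp_continuous h1 fun θ => by
          simpa [abs_of_pos ht0] using ht.2.trans hρ
      exact continuous_const.mul
        ((((h1.pow 2).inv₀ fun θ => pow_ne_zero _ (circleMap_ne_center ht0.ne')).neg.add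
          hqc).norm.pow 2)
    rw [restrict_Ioo_eq_restrict_Ioc, ← ofReal_integral_eq_lintegral_ofReal,
      ← intervalIntegral.integral_of_le (by linarith [Real.pi_pos]),
      intervalIntegral.integral_const_mul]
    · refine ENNReal.ofReal_le_ofReal ?_
      have := mul_le_mul_of_nonneg_left
        (le_integral_norm_sq_circle hq ht0 (ht.2.trans hρ)) ht0.le
      refine le_trans (le_of_eq ?_) this
      field_simp
      rfl
    · exact (hcont.intervalIntegrable (-Real.pi) Real.pi).1
    · exact Eventually.of_forall fun θ => by positivity
  calc ENNReal.ofReal (Real.pi * (1 / r ^ 2 - 1 / ρ ^ 2 + b ^ 2 * (ρ ^ 2 - r ^ 2)))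
      = ∫⁻ t in Ioo r ρ, ENNReal.ofReal (2 * Real.pi * (1 / t ^ 3 + b ^ 2 * t)) := by
        have hcont : ContinuousOn (fun t : ℝ => 2 * Real.pi * (1 / t ^ 3 + b ^ 2 * t))
            (uIcc r ρ) := by
          rw [uIcc_of_le hrρ.le]
          refine continuousOn_const.mul (ContinuousOn.add (continuousOn_const.div (by fun_prop)
            fun t ht => pow_ne_zero _ (hr.trans_le ht.1).ne') (by fun_prop))
        rw [restrict_Ioo_eq_restrict_Ioc, ← ofReal_integral_eq_lintegral_ofReal,
          ← intervalIntegral.integral_of_le hrρ.le]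
        · congr 1
          rw [intervalIntegral.integral_eq_sub_of_hasDerivAt
            (f := fun t => Real.pi * (-(1 / t ^ 2) + b ^ 2 * t ^ 2)) _ hcont.intervalIntegrable]
          · ring
          · intro t ht
            rw [uIcc_of_le hrρ.le] at ht
            have ht0 : t ≠ 0 := (hr.trans_le ht.1).ne'
            have h1 : HasDerivAt (fun t : ℝ => 1 / t ^ 2)
                ((0 * t ^ 2 - 1 * (2 * t)) / (t ^ 2) ^ 2) t := by
              have := (hasDerivAt_const t (1 : ℝ)).fun_div (hasDerivAt_pow 2 t) (pow_ne_zero 2 ht0)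
              simpa using this
            have h2 : HasDerivAt (fun t : ℝ => b ^ 2 * t ^ 2) (b ^ 2 * (2 * t)) t := by
              simpa using (hasDerivAt_pow 2 t).const_mul (b ^ 2)
            refine ((h1.fun_neg.fun_add h2).const_mul Real.pi).congr_deriv ?_
            field_simp
            ring
        · exact hcont.intervalIntegrable.1
        · refine (ae_restrict_iff' measurableSet_Ioc).2 (Eventually.of_forall fun t ht => ?_)
          have : 0 < t := hr.trans ht.1
          simp only [Pi.zero_apply]
          positivity
    _ ≤ ∫⁻ t in Ioo r ρ, ∫⁻ θ in Ioo (-Real.pi) Real.pi,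
          ENNReal.ofReal t • G (Complex.polarCoord.symm (t, θ)) :=
        setLIntegral_mono' measurableSet_Ioo hinner
    _ ≤ _ := lintegral_mono_set fun t ht => hr.trans ht.1

/-- The right side is the value of the left side at t = r. The difference carries the factor t - r,
and the smallness of r keeps the cofactor nonnegative. Hence the inner circle controls the whole
annulus. -/
theorem inv_add_mul_sub_add_mul_sq_le {r t B C : ℝ} (hr : 0 < r) (hrt : r ≤ t) (ht : t ≤ 1)
    (hB : 0 ≤ B) (hC : 0 ≤ C) (hsmall : r * (2 * B + 2 * C) ≤ 1) :
    1 / t + B * (t - r ^ 2 / t) + C * t ^ 2 ≤ 1 / r + C * r ^ 2 := by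
  have ht0 : 0 < t := hr.trans_le hrt
  have key : 1 / r + C * r ^ 2 - (1 / t + B * (t - r ^ 2 / t) + C * t ^ 2) =
      (t - r) * (1 - B * r * (t + r) - C * (r * t) * (t + r)) / (r * t) := by
    field_simp
    ring
  have h1 : B * r * (t + r) ≤ B * r * 2 :=
    mul_le_mul_of_nonneg_left (by linarith) (by positivity)
  have h2 : C * (r * t) * (t + r) ≤ C * (r * 1) * 2 := by
    have h3 : r * t ≤ r * 1 := mul_le_mul_of_nonneg_left ht hr.le
    exact mul_le_mul (mul_le_mul_of_nonneg_left h3 hC) (by linarith) (by positivity)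
      (by positivity)
  have h4 : 0 ≤ (t - r) * (1 - B * r * (t + r) - C * (r * t) * (t + r)) / (r * t) :=
    div_nonneg (mul_nonneg (by linarith) (by nlinarith)) (by positivity)
  linarith

/-- A second order Taylor bound on a smaller disk. -/
theorem exists_norm_sub_deriv_mul_le {p : ℂ → ℂ} (hp : DifferentiableOn ℂ p (ball 0 1))
    (hp0 : p 0 = 0) {ρ : ℝ} (hρ : ρ < 1) :
    ∃ C, 0 ≤ C ∧ ∀ z, ‖z‖ ≤ ρ → ‖p z - deriv p 0 * z‖ ≤ C * ‖z‖ ^ 2 := by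
  have hn : ball (0 : ℂ) 1 ∈ 𝓝 0 := ball_mem_nhds _ one_pos
  have h1 : DifferentiableOn ℂ (dslope p 0) (ball 0 1) := (differentiableOn_dslope hn).2 hp
  have h2 : DifferentiableOn ℂ (dslope (dslope p 0) 0) (ball 0 1) :=
    (differentiableOn_dslope hn).2 h1
  obtain ⟨C, hC⟩ := (isCompact_closedBall (0 : ℂ) ρ).exists_bound_of_continuousOn
    (h2.continuousOn.mono (closedBall_subset_ball hρ))
  refine ⟨max C 0, le_max_right _ _, fun z hz => ?_⟩
  have e1 : z * dslope p 0 z = p z := by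
    have := sub_smul_dslope p 0 z
    simpa [hp0] using this
  have e2 : z * dslope (dslope p 0) 0 z = dslope p 0 z - deriv p 0 := by
    have := sub_smul_dslope (dslope p 0) 0 z
    simpa using this
  have e3 : p z - deriv p 0 * z = dslope (dslope p 0) 0 z * z ^ 2 := by
    linear_combination -e1 - z * e2
  rw [e3, norm_mul, norm_pow]
  exact mul_le_mul_of_nonneg_right
    ((hC z (mem_closedBall_zero_iff.2 hz)).trans (le_max_left _ _)) (by positivity)

/-- The image of a circle under `1/z + b z + O(z²)` is nearly an ellipse. -/
theorem norm_sub_mul_conj_le {b z P : ℂ} {r C : ℝ} (hr : 0 < r) (hrz : r ≤ ‖z‖) (hz1 : ‖z‖ ≤ 1)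
    (hC : 0 ≤ C) (hP : ‖P - b * z‖ ≤ C * ‖z‖ ^ 2) (hsmall : r * (2 * ‖b‖ + 2 * C) ≤ 1) :
    ‖(z⁻¹ + P) - b * r ^ 2 * (starRingEnd ℂ) (z⁻¹ + P)‖ ≤
      1 / r + (C + ‖b‖ * (‖b‖ + C)) * r ^ 2 := by
  have hz0 : 0 < ‖z‖ := hr.trans_le hrz
  have hz : z ≠ 0 := norm_pos_iff.1 hz0
  have hzc : (starRingEnd ℂ) z ≠ 0 := (map_ne_zero _).2 hz
  have hinv : (starRingEnd ℂ) z⁻¹ = z / ‖z‖ ^ 2 := by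
    have : ((‖z‖ : ℂ)) ^ 2 = z * (starRingEnd ℂ) z := by
      rw [mul_conj, normSq_eq_norm_sq]
      push_cast
      ring
    rw [this, map_inv₀]
    field_simp
  -- On |z| = r the conjugate of 1/z is z/r², so subtracting b r² times the conjugate cancels the
  -- term bz; for larger |z| the factor 1 - r²/|z|² remains.
  have hdec : (z⁻¹ + P) - b * r ^ 2 * (starRingEnd ℂ) (z⁻¹ + P) =
      z⁻¹ + b * (z * ((1 - r ^ 2 / ‖z‖ ^ 2 : ℝ) : ℂ)) + (P - b * z) -
        b * r ^ 2 * (starRingEnd ℂ) P := by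
    rw [map_add, hinv]
    push_cast
    ring
  have hPn : ‖P‖ ≤ ‖b‖ + C := by
    calc ‖P‖ = ‖b * z + (P - b * z)‖ := by ring_nf
      _ ≤ ‖b * z‖ + ‖P - b * z‖ := norm_add_le _ _
      _ ≤ ‖b‖ * 1 + C * 1 := by
        rw [norm_mul]
        refine add_le_add (mul_le_mul_of_nonneg_left hz1 (norm_nonneg _)) (hP.trans ?_)
        exact mul_le_mul_of_nonneg_left (pow_le_one₀ (norm_nonneg _) hz1) hC
      _ = _ := by ring
  have hfac : 0 ≤ 1 - r ^ 2 / ‖z‖ ^ 2 := by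
    rw [sub_nonneg, div_le_one (by positivity)]
    exact pow_le_pow_left₀ hr.le hrz 2
  have hmid : ‖b * (z * ((1 - r ^ 2 / ‖z‖ ^ 2 : ℝ) : ℂ))‖ = ‖b‖ * (‖z‖ - r ^ 2 / ‖z‖) := by
    rw [norm_mul, norm_mul, norm_real, Real.norm_eq_abs, abs_of_nonneg hfac]
    field_simp
  have hlast : ‖b * r ^ 2 * (starRingEnd ℂ) P‖ ≤ ‖b‖ * (‖b‖ + C) * r ^ 2 := by
    rw [norm_mul, norm_mul, norm_pow, norm_real, Real.norm_eq_abs, abs_of_pos hr, RCLike.norm_conj]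
    calc ‖b‖ * r ^ 2 * ‖P‖ ≤ ‖b‖ * r ^ 2 * (‖b‖ + C) :=
          mul_le_mul_of_nonneg_left hPn (by positivity)
      _ = _ := by ring
  rw [hdec]
  have h1 := norm_sub_le (z⁻¹ + b * (z * ((1 - r ^ 2 / ‖z‖ ^ 2 : ℝ) : ℂ)) + (P - b * z))
    (b * r ^ 2 * (starRingEnd ℂ) P)
  have h2 := norm_add₃_le (a := z⁻¹) (b := b * (z * ((1 - r ^ 2 / ‖z‖ ^ 2 : ℝ) : ℂ)))
    (c := P - b * z)
  have h3 := inv_add_mul_sub_add_mul_sq_le hr hrz hz1 (norm_nonneg b) hC hsmall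
  rw [hmid, norm_inv, inv_eq_one_div ‖z‖] at h2
  linarith

/-- Comparison of the area of the image of an annulus with that of the surrounding ellipse. -/
theorem area_inequality {p : ℂ → ℂ} (hp : DifferentiableOn ℂ p (ball 0 1))
    (hinj : InjOn (fun z => z⁻¹ + p z) (ball 0 1 \ {0})) {r ρ C : ℝ} (hr : 0 < r) (hrρ : r < ρ)
    (hρ : ρ < 1) (hC : 0 ≤ C) (hCp : ∀ z, ‖z‖ ≤ ρ → ‖p z - deriv p 0 * z‖ ≤ C * ‖z‖ ^ 2)
    (hsmall : r * (2 * ‖deriv p 0‖ + 2 * C) ≤ 1) :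
    (1 / r ^ 2 - 1 / ρ ^ 2 + ‖deriv p 0‖ ^ 2 * (ρ ^ 2 - r ^ 2)) *
        (1 - ‖deriv p 0‖ ^ 2 * r ^ 4) ≤
      (1 / r + (C + ‖deriv p 0‖ * (‖deriv p 0‖ + C)) * r ^ 2) ^ 2 := by
  set b := deriv p 0 with hb
  set M := 1 / r + (C + ‖b‖ * (‖b‖ + C)) * r ^ 2 with hM
  have hM0 : 0 ≤ M := by positivity
  let S : Set ℂ := {z : ℂ | r < ‖z‖ ∧ ‖z‖ < ρ}
  have hmeasS : MeasurableSet S :=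
    ((isOpen_lt continuous_const continuous_norm).inter
      (isOpen_lt continuous_norm continuous_const)).measurableSet
  let k : ℂ → ℂ := fun z => z⁻¹ + p z
  have hSne : ∀ z ∈ S, z ≠ 0 := fun z hz => norm_pos_iff.1 (hr.trans hz.1)
  have hSball : ∀ z ∈ S, z ∈ ball (0 : ℂ) 1 := fun z hz =>
    mem_ball_zero_iff.2 (hz.2.trans hρ)
  have hSsub : S ⊆ ball 0 1 \ {0} := fun z hz => ⟨hSball z hz, hSne z hz⟩
  have hinjS : InjOn k S := hinj.mono hSsub
  let k' : ℂ → ℂ →L[ℝ] ℂ := fun z =>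
    (ContinuousLinearMap.toSpanSingleton ℂ (-(z ^ 2)⁻¹ + deriv p z)).restrictScalars ℝ
  have hk' : ∀ z ∈ S, HasFDerivWithinAt k (k' z) S z := by
    intro z hz
    have h1 : HasDerivAt k (-(z ^ 2)⁻¹ + deriv p z) z :=
      (hasDerivAt_inv (hSne z hz)).add
        (hp.differentiableAt (isOpen_ball.mem_nhds (hSball z hz))).hasDerivAt
    exact (h1.hasFDerivAt.restrictScalars ℝ).hasFDerivWithinAt
  have hdet : ∀ z, |(k' z).det| = ‖-(z ^ 2)⁻¹ + deriv p z‖ ^ 2 := by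
    intro z
    have : (k' z).det = ‖-(z ^ 2)⁻¹ + deriv p z‖ ^ 2 - ‖(0 : ℂ)‖ ^ 2 :=
      det_mul_add_mul_conj _ 0 _ fun d => by simp [k', mul_comm]
    rw [this]
    simp
  have harea := lintegral_abs_det_fderiv_eq_addHaar_image volume hmeasS hk' hinjS
  simp only [hdet] at harea
  have hlow := le_lintegral_annulus (measurable_deriv p)
    (hp.deriv isOpen_ball) hr hrρ hρ
  rw [harea] at hlow
  -- T turns the near-ellipse into a near-disk of radius 1/r + O(r²). Enclosing the image in a disk
  -- directly would cost a term |b| r in the radius, hence 2|b| in its square, which survives as r →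
  -- 0.
  let T : ℂ →ₗ[ℝ] ℂ := LinearMap.id - (b * r ^ 2) • (conjAe.toLinearMap : ℂ →ₗ[ℝ] ℂ)
  have hT : ∀ w, T w = w - b * r ^ 2 * (starRingEnd ℂ) w := fun w => by simp [T]
  have hTdet : LinearMap.det T = 1 - ‖b‖ ^ 2 * r ^ 4 := by
    rw [det_mul_add_mul_conj 1 (-(b * r ^ 2)) T fun d => by rw [hT]; ring]
    rw [norm_neg, norm_mul, norm_pow, norm_real, Real.norm_eq_abs, abs_of_pos hr]
    simp only [norm_one]
    ring
  have hbr : ‖b‖ * r ^ 2 < 1 := by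
    have hr1 : r < 1 := hrρ.trans hρ
    nlinarith [norm_nonneg b, mul_nonneg (norm_nonneg b) hr.le]
  have hdpos : 0 < 1 - ‖b‖ ^ 2 * r ^ 4 := by
    nlinarith [mul_nonneg (norm_nonneg b) (sq_nonneg r)]
  have hsub : k '' S ⊆ T ⁻¹' closedBall 0 M := by
    rintro _ ⟨z, hz, rfl⟩
    rw [mem_preimage, mem_closedBall_zero_iff, hT]
    exact norm_sub_mul_conj_le hr hz.1.le (hz.2.trans hρ).le hC (hCp z hz.2.le) hsmall
  have hup := measure_mono (μ := volume) hsub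
  rw [Measure.addHaar_preimage_linearMap volume (by rw [hTdet]; exact hdpos.ne'), hTdet,
    Complex.volume_closedBall, abs_of_pos (inv_pos.2 hdpos), ← ENNReal.ofReal_pow hM0] at hup
  have hpi : ((NNReal.pi : NNReal) : ENNReal) = ENNReal.ofReal Real.pi := by
    rw [ENNReal.ofReal, ← NNReal.coe_real_pi, Real.toNNReal_coe]
  rw [hpi, ← ENNReal.ofReal_mul (by positivity), ← ENNReal.ofReal_mul (by positivity)] at hup
  have hfin := (ENNReal.ofReal_le_ofReal_iff (by positivity)).1 (hlow.trans hup)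
  have hfin2 : 1 / r ^ 2 - 1 / ρ ^ 2 + ‖b‖ ^ 2 * (ρ ^ 2 - r ^ 2) ≤
      M ^ 2 / (1 - ‖b‖ ^ 2 * r ^ 4) := by
    have : (1 - ‖b‖ ^ 2 * r ^ 4)⁻¹ * (M ^ 2 * Real.pi) =
        Real.pi * (M ^ 2 / (1 - ‖b‖ ^ 2 * r ^ 4)) := by
      ring
    rw [this] at hfin
    exact le_of_mul_le_mul_left hfin Real.pi_pos
  rwa [le_div_iff₀ hdpos] at hfin2

/-- A consequence of the area theorem: if `1/z + p(z)` is injective in the punctured unit disk and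
`p(0) = 0`, then `|p'(0)| ≤ 1`. -/
theorem norm_deriv_le_one_of_injOn_inv_add {p : ℂ → ℂ} (hp : DifferentiableOn ℂ p (ball 0 1))
    (hp0 : p 0 = 0) (hinj : InjOn (fun z => z⁻¹ + p z) (ball 0 1 \ {0})) :
    ‖deriv p 0‖ ≤ 1 := by
  set B := ‖deriv p 0‖ with hB
  have hB0 : 0 ≤ B := norm_nonneg _
  have hstep : ∀ ρ : ℝ, 0 < ρ → ρ < 1 → B * ρ ^ 2 ≤ 1 := by
    intro ρ hρ0 hρ
    obtain ⟨C, hC, hCp⟩ := exists_norm_sub_deriv_mul_le hp hp0 hρ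
    set K := C + B * (B + C) with hK
    have hev : ∀ᶠ r : ℝ in 𝓝[>] 0, B ^ 2 * ρ ^ 2 - 1 / ρ ^ 2 ≤
        2 * K * r + K ^ 2 * r ^ 4 + 2 * B ^ 2 * r ^ 2 + B ^ 4 * ρ ^ 2 * r ^ 4 := by
      have hs : ∀ᶠ r : ℝ in 𝓝[>] 0, r * (2 * B + 2 * C) < 1 := by
        have : Tendsto (fun r : ℝ => r * (2 * B + 2 * C)) (𝓝[>] 0) (𝓝 (0 * (2 * B + 2 * C))) :=
          ((continuous_id.mul continuous_const).tendsto 0).mono_left nhdsWithin_le_nhds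
        rw [zero_mul] at this
        exact this.eventually_lt_const one_pos
      filter_upwards [self_mem_nhdsWithin, hs, Ioo_mem_nhdsGT hρ0] with r hr hrs hrρ
      have hr0 : 0 < r := hr
      have h := area_inequality hp hinj hr0 hrρ.2 hρ hC hCp hrs.le
      -- Both sides contain the same singular term 1/r². After cancellation, r → 0 gives |b|²ρ² ≤
      -- 1/ρ², and then ρ → 1.
      have e1 : (1 / r ^ 2 - 1 / ρ ^ 2 + B ^ 2 * (ρ ^ 2 - r ^ 2)) * (1 - B ^ 2 * r ^ 4) =
          1 / r ^ 2 - 1 / ρ ^ 2 + B ^ 2 * ρ ^ 2 - 2 * B ^ 2 * r ^ 2 + B ^ 2 * r ^ 4 / ρ ^ 2 -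
            B ^ 4 * ρ ^ 2 * r ^ 4 + B ^ 4 * r ^ 6 := by
        field_simp
        ring
      have e2 : (1 / r + K * r ^ 2) ^ 2 = 1 / r ^ 2 + 2 * K * r + K ^ 2 * r ^ 4 := by
        field_simp
        ring
      rw [← hB, ← hK, e1, e2] at h
      have h3 : 0 ≤ B ^ 2 * r ^ 4 / ρ ^ 2 := by positivity
      have h4 : 0 ≤ B ^ 4 * r ^ 6 := by positivity
      linarith
    have hlim : Tendsto (fun r : ℝ => 2 * K * r + K ^ 2 * r ^ 4 + 2 * B ^ 2 * r ^ 2 +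
        B ^ 4 * ρ ^ 2 * r ^ 4) (𝓝[>] 0) (𝓝 0) := by
      have hc : Continuous fun r : ℝ => 2 * K * r + K ^ 2 * r ^ 4 + 2 * B ^ 2 * r ^ 2 +
        B ^ 4 * ρ ^ 2 * r ^ 4 := by fun_prop
      have := (hc.tendsto 0).mono_left (nhdsWithin_le_nhds (s := Ioi (0 : ℝ)))
      simpa using this
    have hle := ge_of_tendsto hlim hev
    have hsq : (B * ρ ^ 2) ^ 2 ≤ 1 := by
      have h5 : B ^ 2 * ρ ^ 2 ≤ 1 / ρ ^ 2 := by linarith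
      rw [le_div_iff₀ (by positivity)] at h5
      calc (B * ρ ^ 2) ^ 2 = B ^ 2 * ρ ^ 2 * ρ ^ 2 := by ring
        _ ≤ 1 := h5
    exact (sq_le_one_iff₀ (by positivity)).1 hsq
  have hlim : Tendsto (fun ρ : ℝ => B * ρ ^ 2) (𝓝[<] 1) (𝓝 B) := by
    have hc : Continuous fun ρ : ℝ => B * ρ ^ 2 := by fun_prop
    have := (hc.tendsto 1).mono_left (nhdsWithin_le_nhds (s := Iio (1 : ℝ)))
    simpa using this
  refine le_of_tendsto hlim ?_
  filter_upwards [Ioo_mem_nhdsLT zero_lt_one] with ρ hρ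
  exact hstep ρ hρ.1 hρ.2

/-! ### The Kraus–Nehari theorem -/

/-- The derivatives at the origin of `c + z u(z)` in terms of those of `u`. -/
theorem derivs_of_eventuallyEq_const_add_mul {F u : ℂ → ℂ} {c : ℂ} (hu : AnalyticAt ℂ u 0)
    (hF : ∀ᶠ z in 𝓝 0, F z = c + z * u z) :
    deriv F 0 = u 0 ∧ deriv (deriv F) 0 = 2 * deriv u 0 ∧
      deriv (deriv (deriv F)) 0 = 3 * deriv (deriv u) 0 := by
  have h1 : deriv F =ᶠ[𝓝 0] fun z => u z + z * deriv u z := by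
    filter_upwards [hF.eventually_nhds, hu.eventually_analyticAt] with z hz huz
    rw [EventuallyEq.deriv_eq hz]
    have := (((hasDerivAt_id' z).fun_mul huz.differentiableAt.hasDerivAt).const_add c).deriv
    rw [this]
    ring
  have h2 : deriv (deriv F) =ᶠ[𝓝 0] fun z => 2 * deriv u z + z * deriv (deriv u) z := by
    filter_upwards [h1.eventually_nhds, hu.eventually_analyticAt] with z hz huz
    rw [EventuallyEq.deriv_eq hz]
    have := (huz.differentiableAt.hasDerivAt.fun_add
      ((hasDerivAt_id' z).fun_mul huz.deriv.differentiableAt.hasDerivAt)).deriv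
    rw [this]
    ring
  refine ⟨by simpa using h1.self_of_nhds, by simpa using h2.self_of_nhds, ?_⟩
  rw [h2.deriv_eq]
  have := ((hu.deriv.differentiableAt.hasDerivAt.const_mul 2).fun_add
    ((hasDerivAt_id' (0 : ℂ)).fun_mul hu.deriv.deriv.differentiableAt.hasDerivAt)).deriv
  rw [this]
  ring

/-- The second derivative of `c / u` at a zero of `u - c`. -/
theorem deriv_deriv_const_div {u : ℂ → ℂ} {c : ℂ} (hc : c ≠ 0) (hu : AnalyticAt ℂ u 0)
    (hu0 : u 0 = c) :
    deriv (deriv fun z => c / u z) 0 =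
      -deriv (deriv u) 0 / c + 2 * deriv u 0 ^ 2 / c ^ 2 := by
  have hne : ∀ᶠ z in 𝓝 0, u z ≠ 0 := hu.continuousAt.eventually_ne (by rwa [hu0])
  have h1 : deriv (fun z => c / u z) =ᶠ[𝓝 0] fun z => -c * deriv u z / u z ^ 2 := by
    filter_upwards [hne, hu.eventually_analyticAt] with z hz huz
    have := ((hasDerivAt_const z c).fun_div huz.differentiableAt.hasDerivAt hz).deriv
    rw [this]
    ring
  rw [h1.deriv_eq]
  have h2 := (((hu.deriv.differentiableAt.hasDerivAt.const_mul (-c))).fun_div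
    (hu.differentiableAt.hasDerivAt.fun_pow 2) (by rw [hu0]; exact pow_ne_zero 2 hc)).deriv
  rw [h2, hu0]
  field_simp
  push_cast
  ring

/-- The bound `|a₂² - a₃| ≤ 1` for univalent functions, without normalization. -/
theorem norm_schwarzian_zero_le {G : ℂ → ℂ} (hG : DifferentiableOn ℂ G (ball 0 1))
    (hinj : InjOn G (ball 0 1)) (hG' : deriv G 0 ≠ 0) :
    ‖deriv (deriv (deriv G)) 0 / deriv G 0 -
      3 / 2 * (deriv (deriv G) 0 / deriv G 0) ^ 2‖ ≤ 6 := by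
  have hn : ball (0 : ℂ) 1 ∈ 𝓝 0 := ball_mem_nhds _ one_pos
  have h0 : (0 : ℂ) ∈ ball (0 : ℂ) 1 := mem_ball_self one_pos
  set u := dslope G 0 with hu
  have hud : DifferentiableOn ℂ u (ball 0 1) := (differentiableOn_dslope hn).2 hG
  have huA : AnalyticAt ℂ u 0 := hud.analyticAt hn
  have hfac : ∀ z, G z = G 0 + z * u z := by
    intro z
    have := sub_smul_dslope G 0 z
    rw [sub_zero, smul_eq_mul] at this
    rw [hu, this]
    ring
  obtain ⟨d1, d2, d3⟩ := derivs_of_eventuallyEq_const_add_mul huA (Eventually.of_forall hfac)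
  have hune : ∀ z ∈ ball (0 : ℂ) 1, u z ≠ 0 := by
    intro z hz hz0
    by_cases hzz : z = 0
    · rw [hzz, ← d1] at hz0
      exact hG' hz0
    · have := hfac z
      rw [hz0, mul_zero, add_zero] at this
      exact hzz (hinj hz h0 this)
  set c := u 0 with hc
  have hc0 : c ≠ 0 := hune 0 h0
  have hvd : DifferentiableOn ℂ (fun z => c / u z) (ball 0 1) :=
    (differentiableOn_const c).fun_div hud hune
  -- Since G - G(0) = z u, the function c/(G - G(0)) equals 1/z + P(z). It is univalent along with
  -- G, and P'(0) is -1/6 of the Schwarzian of G at 0.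
  set P := dslope (fun z => c / u z) 0 with hP
  have hPd : DifferentiableOn ℂ P (ball 0 1) := (differentiableOn_dslope hn).2 hvd
  have hPfac : ∀ z, c / u z = 1 + z * P z := by
    intro z
    have := sub_smul_dslope (fun z => c / u z) 0 z
    rw [sub_zero, smul_eq_mul, ← hc, div_self hc0] at this
    rw [hP, this]
    ring
  obtain ⟨-, e2, -⟩ := derivs_of_eventuallyEq_const_add_mul (hPd.analyticAt hn)
    (Eventually.of_forall hPfac)
  rw [deriv_deriv_const_div hc0 huA hc.symm] at e2
  have hpd : deriv (fun z => P z - P 0) 0 = deriv P 0 := deriv_sub_const _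
  have hle := norm_deriv_le_one_of_injOn_inv_add (p := fun z => P z - P 0)
    (hPd.sub_const _) (sub_self _) ?_
  · rw [hpd] at hle
    have : deriv (deriv (deriv G)) 0 / deriv G 0 -
        3 / 2 * (deriv (deriv G) 0 / deriv G 0) ^ 2 = -6 * deriv P 0 := by
      rw [d1, d2, d3]
      linear_combination (-3) * e2
    rw [this, norm_mul, norm_neg]
    norm_num
    linarith
  · have hk : ∀ z ∈ ball (0 : ℂ) 1 \ {0}, z⁻¹ + (P z - P 0) = c / (G z - G 0) - P 0 := by
      rintro z ⟨hz, hz0⟩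
      have hz0' : z ≠ 0 := hz0
      have e : G z - G 0 = z * u z := by rw [hfac z]; ring
      have e' : c / (z * u z) = z⁻¹ * (c / u z) := by
        field_simp
      rw [e, e', hPfac z]
      field_simp
      ring
    intro z hz w hw hzw
    simp only [hk z hz, hk w hw] at hzw
    have hzw' : c / (G z - G 0) = c / (G w - G 0) := sub_left_injective hzw
    rw [div_eq_mul_inv, div_eq_mul_inv] at hzw'
    have := inv_injective (mul_left_cancel₀ hc0 hzw')
    exact hinj hz.1 hw.1 (sub_left_injective this)

theorem classicalSchwarzian_eq {F : ℂ → ℂ} {z : ℂ} (hF : AnalyticAt ℂ F z) (hF' : deriv F z ≠ 0) :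
    classicalSchwarzian F z = deriv (deriv (deriv F)) z / deriv F z -
      3 / 2 * (deriv (deriv F) z / deriv F z) ^ 2 := by
  have h1 : deriv (preSchwarzian F) z =
      (deriv (deriv (deriv F)) z * deriv F z - deriv (deriv F) z * deriv (deriv F) z) /
        deriv F z ^ 2 :=
    (hF.deriv.deriv.differentiableAt.hasDerivAt.fun_div
      hF.deriv.differentiableAt.hasDerivAt hF').deriv
  rw [classicalSchwarzian, h1, preSchwarzian]
  field_simp
  ring

theorem one_add_conj_mul_ne_zero {a z : ℂ} (ha : ‖a‖ < 1) (hz : ‖z‖ < 1) :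
    1 + (starRingEnd ℂ) a * z ≠ 0 := by
  intro h
  have h1 : ‖(starRingEnd ℂ) a * z‖ = 1 := by
    rw [eq_neg_of_add_eq_zero_right h, norm_neg, norm_one]
  rw [norm_mul, RCLike.norm_conj] at h1
  nlinarith [norm_nonneg a, norm_nonneg z]

theorem norm_mobius_lt_one {a z : ℂ} (ha : ‖a‖ < 1) (hz : ‖z‖ < 1) :
    ‖(z + a) / (1 + (starRingEnd ℂ) a * z)‖ < 1 := by
  rw [norm_div, div_lt_one (norm_pos_iff.2 (one_add_conj_mul_ne_zero ha hz))]
  refine lt_of_pow_lt_pow_left₀ 2 (norm_nonneg _) ?_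
  have key : ‖1 + (starRingEnd ℂ) a * z‖ ^ 2 - ‖z + a‖ ^ 2 =
      (1 - ‖a‖ ^ 2) * (1 - ‖z‖ ^ 2) := by
    simp only [← normSq_eq_norm_sq, normSq_apply, add_re, add_im, mul_re, mul_im, conj_re, conj_im,
      one_re, one_im]
    ring
  have h1 : 0 < 1 - ‖a‖ ^ 2 := by nlinarith [norm_nonneg a]
  have h2 : 0 < 1 - ‖z‖ ^ 2 := by nlinarith [norm_nonneg z]
  have := mul_pos h1 h2
  linarith

/-- The Kraus–Nehari theorem: a univalent function `F` of the unit disk satisfies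
`|S F(z)| (1 - |z|²)² ≤ 6`. -/
theorem norm_classicalSchwarzian_mul_le {F : ℂ → ℂ} (hF : DifferentiableOn ℂ F (ball 0 1))
    (hinj : InjOn F (ball 0 1)) {a : ℂ} (ha : a ∈ ball (0 : ℂ) 1) (hF' : deriv F a ≠ 0) :
    ‖classicalSchwarzian F a‖ * (1 - ‖a‖ ^ 2) ^ 2 ≤ 6 := by
  have ha1 : ‖a‖ < 1 := mem_ball_zero_iff.1 ha
  set a' := (starRingEnd ℂ) a with ha'
  set s : ℂ := 1 - a' * a with hs
  have hsr : s = ((1 - ‖a‖ ^ 2 : ℝ) : ℂ) := by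
    rw [hs, ha', mul_comm, mul_conj, normSq_eq_norm_sq]
    push_cast
    ring
  have hspos : 0 < 1 - ‖a‖ ^ 2 := by nlinarith [norm_nonneg a]
  have hs0 : s ≠ 0 := by
    rw [hsr]
    exact ofReal_ne_zero.2 hspos.ne'
  -- This automorphism sends 0 to a with derivative s = 1 - |a|², and the Schwarzian of F ∘ m at 0
  -- is that of F at a times s².
  let m : ℂ → ℂ := fun z => (z + a) / (1 + a' * z)
  have hD : ∀ z ∈ ball (0 : ℂ) 1, 1 + a' * z ≠ 0 := fun z hz =>
    one_add_conj_mul_ne_zero ha1 (mem_ball_zero_iff.1 hz)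
  have hm : ∀ z ∈ ball (0 : ℂ) 1, m z ∈ ball (0 : ℂ) 1 := fun z hz =>
    mem_ball_zero_iff.2 (norm_mobius_lt_one ha1 (mem_ball_zero_iff.1 hz))
  have hDd : ∀ z, HasDerivAt (fun z => 1 + a' * z) a' z := fun z => by
    simpa using ((hasDerivAt_id' z).const_mul a').const_add 1
  have hmd : ∀ z ∈ ball (0 : ℂ) 1, HasDerivAt m (s / (1 + a' * z) ^ 2) z := by
    intro z hz
    refine (((hasDerivAt_id' z).add_const a).fun_div (hDd z) (hD z hz)).congr_deriv ?_
    rw [hs]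
    congr 1
    ring
  have hFm : ∀ z ∈ ball (0 : ℂ) 1, AnalyticAt ℂ F (m z) := fun z hz =>
    hF.analyticAt (isOpen_ball.mem_nhds (hm z hz))
  have hminj : InjOn m (ball 0 1) := by
    intro z hz w hw hzw
    simp only [m] at hzw
    rw [div_eq_div_iff (hD z hz) (hD w hw)] at hzw
    have : s * (z - w) = 0 := by
      rw [hs]
      linear_combination hzw
    exact sub_eq_zero.1 ((mul_eq_zero.1 this).resolve_left hs0)
  let G : ℂ → ℂ := fun z => F (m z)
  have hGd : ∀ z ∈ ball (0 : ℂ) 1, HasDerivAt G (s * deriv F (m z) / (1 + a' * z) ^ 2) z := by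
    intro z hz
    refine ((hFm z hz).differentiableAt.hasDerivAt.comp z (hmd z hz)).congr_deriv ?_
    ring
  have hev : ∀ᶠ z in 𝓝 (0 : ℂ), z ∈ ball (0 : ℂ) 1 := ball_mem_nhds _ one_pos
  have h0 : (0 : ℂ) ∈ ball (0 : ℂ) 1 := mem_ball_self one_pos
  have g1 : deriv G =ᶠ[𝓝 0] fun z => s * deriv F (m z) / (1 + a' * z) ^ 2 := by
    filter_upwards [hev] with z hz
    exact (hGd z hz).deriv
  have g2 : deriv (deriv G) =ᶠ[𝓝 0] fun z => s ^ 2 * deriv (deriv F) (m z) / (1 + a' * z) ^ 4 -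
      2 * a' * s * deriv F (m z) / (1 + a' * z) ^ 3 := by
    filter_upwards [g1.eventually_nhds, hev] with z hz hzb
    rw [EventuallyEq.deriv_eq hz]
    have hDz := hD z hzb
    have h1 := ((hFm z hzb).deriv.differentiableAt.hasDerivAt.comp z (hmd z hzb)).const_mul s
    refine ((h1.fun_div ((hDd z).fun_pow 2) (pow_ne_zero 2 hDz)).congr_deriv ?_).deriv
    simp only [Function.comp_apply]
    field_simp
    push_cast
    ring
  have hm0 : m 0 = a := by simp [m]
  have hFa : AnalyticAt ℂ F a := hm0 ▸ hFm 0 h0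
  have v1 : deriv G 0 = s * deriv F a := by
    rw [g1.self_of_nhds]
    simp [hm0]
  have v2 : deriv (deriv G) 0 = s ^ 2 * deriv (deriv F) a - 2 * a' * s * deriv F a := by
    rw [g2.self_of_nhds]
    simp [hm0]
  have v3 : deriv (deriv (deriv G)) 0 = s ^ 3 * deriv (deriv (deriv F)) a -
      6 * a' * s ^ 2 * deriv (deriv F) a + 6 * a' ^ 2 * s * deriv F a := by
    rw [g2.deriv_eq]
    have hD0 := hD 0 h0
    have h1 := ((hFm 0 h0).deriv.differentiableAt.hasDerivAt.comp 0 (hmd 0 h0)).const_mul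
      (2 * a' * s)
    have h2 := ((hFm 0 h0).deriv.deriv.differentiableAt.hasDerivAt.comp 0 (hmd 0 h0)).const_mul
      (s ^ 2)
    refine (((h2.fun_div ((hDd 0).fun_pow 4) (pow_ne_zero 4 hD0)).fun_sub
      (h1.fun_div ((hDd 0).fun_pow 3) (pow_ne_zero 3 hD0))).congr_deriv ?_).deriv
    simp only [Function.comp_apply, hm0, mul_zero, add_zero, one_pow, div_one, mul_one]
    push_cast
    ring
  have hG' : deriv G 0 ≠ 0 := by
    rw [v1]
    exact mul_ne_zero hs0 hF'
  have hle := norm_schwarzian_zero_le (G := G)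
    (fun z hz => (hGd z hz).differentiableAt.differentiableWithinAt)
    (hinj.comp hminj hm) hG'
  have heq : deriv (deriv (deriv G)) 0 / deriv G 0 -
      3 / 2 * (deriv (deriv G) 0 / deriv G 0) ^ 2 = classicalSchwarzian F a * s ^ 2 := by
    rw [classicalSchwarzian_eq hFa hF', v1, v2, v3]
    field_simp
    ring
  rw [heq, norm_mul, norm_pow, hsr, norm_real, Real.norm_eq_abs, abs_of_pos hspos] at hle
  exact hle

/-! ### From the harmonic to the classical Schwarzian -/

/-- At each point the Schwarzian derivative of `h + conj g` is the classical one of `h + a g`, with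
`a` the opposite of the conjugate of the dilatation at that point. -/
theorem sensePreservingSchwarzian_eq {h g : ℂ → ℂ} {z : ℂ} (hh : AnalyticAt ℂ h z)
    (hg : AnalyticAt ℂ g z) (hh' : deriv h z ≠ 0) {a : ℂ}
    (ha : a = -(starRingEnd ℂ) (dilatation h g z)) (hF' : deriv h z + a * deriv g z ≠ 0) :
    deriv (fun w => h w + a * g w) z = deriv h z + a * deriv g z ∧
      sensePreservingSchwarzian h g z = classicalSchwarzian (fun w => h w + a * g w) z := by
  have hF : AnalyticAt ℂ (fun w => h w + a * g w) z := hh.add (analyticAt_const.mul hg)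
  have hadd : ∀ {p q : ℂ → ℂ} {w : ℂ}, AnalyticAt ℂ p w → AnalyticAt ℂ q w →
      deriv (fun w => p w + a * q w) w = deriv p w + a * deriv q w := fun hp hq =>
    (hp.differentiableAt.hasDerivAt.fun_add (hq.differentiableAt.hasDerivAt.const_mul a)).deriv
  have f1 : deriv (fun w => h w + a * g w) =ᶠ[𝓝 z] fun w => deriv h w + a * deriv g w := by
    filter_upwards [hh.eventually_analyticAt, hg.eventually_analyticAt] with w hw hw'
    exact hadd hw hw'
  have f2 : deriv (deriv fun w => h w + a * g w) =ᶠ[𝓝 z]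
      fun w => deriv (deriv h) w + a * deriv (deriv g) w := by
    filter_upwards [f1.eventually_nhds, hh.eventually_analyticAt, hg.eventually_analyticAt]
      with w hw hw1 hw2
    rw [EventuallyEq.deriv_eq hw]
    exact hadd hw1.deriv hw2.deriv
  have f3 : deriv (deriv (deriv fun w => h w + a * g w)) z =
      deriv (deriv (deriv h)) z + a * deriv (deriv (deriv g)) z := by
    rw [f2.deriv_eq]
    exact hadd hh.deriv.deriv hg.deriv.deriv
  refine ⟨f1.self_of_nhds, ?_⟩
  have hne : ∀ᶠ w in 𝓝 z, deriv h w ≠ 0 := hh.deriv.continuousAt.eventually_ne hh'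
  have w1 : deriv (dilatation h g) =ᶠ[𝓝 z] fun w =>
      (deriv (deriv g) w * deriv h w - deriv g w * deriv (deriv h) w) / deriv h w ^ 2 := by
    filter_upwards [hh.eventually_analyticAt, hg.eventually_analyticAt, hne] with w hw hw' hw0
    exact (hw'.deriv.differentiableAt.hasDerivAt.fun_div
      hw.deriv.differentiableAt.hasDerivAt hw0).deriv
  have w2 : deriv (deriv (dilatation h g)) z =
      deriv (deriv (deriv g)) z / deriv h z -
        2 * deriv (deriv g) z * deriv (deriv h) z / deriv h z ^ 2 -
        deriv g z * deriv (deriv (deriv h)) z / deriv h z ^ 2 +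
        2 * deriv g z * deriv (deriv h) z ^ 2 / deriv h z ^ 3 := by
    rw [w1.deriv_eq]
    have dh1 := hh.deriv.differentiableAt.hasDerivAt
    have dh2 := hh.deriv.deriv.differentiableAt.hasDerivAt
    have dg1 := hg.deriv.differentiableAt.hasDerivAt
    have dg2 := hg.deriv.deriv.differentiableAt.hasDerivAt
    refine ((((dg2.fun_mul dh1).fun_sub (dg1.fun_mul dh2)).fun_div (dh1.fun_pow 2)
      (pow_ne_zero 2 hh')).congr_deriv ?_).deriv
    field_simp
    push_cast
    ring
  have hω : (starRingEnd ℂ) (dilatation h g z) = -a := by rw [ha, neg_neg]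
  -- Since conj ω(z) = -a, the denominator 1 - |ω|² becomes 1 + aω = (h' + a g')/h' at z, and the
  -- conjugates disappear from the formula.
  have hden : (1 : ℂ) - (‖dilatation h g z‖ : ℂ) ^ 2 =
      (deriv h z + a * deriv g z) / deriv h z := by
    have : ((‖dilatation h g z‖ : ℂ)) ^ 2 =
        dilatation h g z * (starRingEnd ℂ) (dilatation h g z) := by
      rw [mul_conj, normSq_eq_norm_sq]
      push_cast
      ring
    rw [this, hω, dilatation]
    field_simp
    ring
  have hF1 : deriv (fun w => h w + a * g w) z ≠ 0 := by rwa [f1.self_of_nhds]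
  rw [classicalSchwarzian_eq hF hF1, f3, f2.self_of_nhds, f1.self_of_nhds,
    sensePreservingSchwarzian, classicalSchwarzian_eq hh hh', hden, hω, w2, w1.self_of_nhds,
    preSchwarzian]
  field_simp
  ring

/-- The bound for sense-preserving convex harmonic mappings. -/
theorem norm_sensePreservingSchwarzian_mul_le {h g : ℂ → ℂ}
    (hh : DifferentiableOn ℂ h (ball 0 1)) (hg : DifferentiableOn ℂ g (ball 0 1))
    (hinj : InjOn (fun z => h z + (starRingEnd ℂ) (g z)) (ball 0 1))
    (hconv : Convex ℝ ((fun z => h z + (starRingEnd ℂ) (g z)) '' ball 0 1))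
    (hJ : ∀ z ∈ ball (0 : ℂ) 1, 0 < jacobian h g z) {z : ℂ} (hz : z ∈ ball (0 : ℂ) 1) :
    ‖sensePreservingSchwarzian h g z‖ * (1 - ‖z‖ ^ 2) ^ 2 ≤ 6 := by
  have hlt : ∀ w ∈ ball (0 : ℂ) 1, ‖deriv g w‖ < ‖deriv h w‖ := fun w hw =>
    lt_of_pow_lt_pow_left₀ 2 (norm_nonneg _) (sub_pos.1 (hJ w hw))
  have hz' := isOpen_ball.mem_nhds hz
  have hpos : 0 < ‖deriv h z‖ := (norm_nonneg _).trans_lt (hlt z hz)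
  have hh0 : deriv h z ≠ 0 := norm_pos_iff.1 hpos
  set a := -(starRingEnd ℂ) (dilatation h g z) with ha
  have ha1 : ‖a‖ < 1 := by
    rw [ha, norm_neg, RCLike.norm_conj, dilatation, norm_div, div_lt_one hpos]
    exact hlt z hz
  have hF' : deriv h z + a * deriv g z ≠ 0 := by
    intro h0
    have h1 := congrArg norm (eq_neg_of_add_eq_zero_left h0)
    rw [norm_neg, norm_mul] at h1
    nlinarith [hlt z hz, norm_nonneg a, norm_nonneg (deriv g z)]
  obtain ⟨e1, e2⟩ := sensePreservingSchwarzian_eq (hh.analyticAt hz') (hg.analyticAt hz') hh0 ha hF'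
  rw [e2]
  exact norm_classicalSchwarzian_mul_le (hh.fun_add (hg.const_mul a))
    (injOn_add_mul_of_convex_image isOpen_ball hh hg hinj hconv hlt ha1) hz (by rwa [e1])

/-- The Jacobian of an injective harmonic mapping of the unit disk has constant sign. -/
theorem jacobian_pos_or_neg {h g : ℂ → ℂ} (hh : DifferentiableOn ℂ h (ball 0 1))
    (hg : DifferentiableOn ℂ g (ball 0 1)) (hJ : ∀ z ∈ ball (0 : ℂ) 1, jacobian h g z ≠ 0) :
    (∀ z ∈ ball (0 : ℂ) 1, 0 < jacobian h g z) ∨ ∀ z ∈ ball (0 : ℂ) 1, jacobian h g z < 0 := by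
  have hcont : ContinuousOn (jacobian h g) (ball 0 1) :=
    ((hh.deriv isOpen_ball).continuousOn.norm.pow 2).sub
      ((hg.deriv isOpen_ball).continuousOn.norm.pow 2)
  by_contra! hcon
  obtain ⟨⟨z, hz, hz0⟩, w, hw, hw0⟩ := hcon
  obtain ⟨x, hx, hx0⟩ := (convex_ball (0 : ℂ) 1).isPreconnected.intermediate_value hz hw hcont
    ⟨hz0, hw0⟩
  exact hJ x hx hx0

end HarmonicSchwarzian

open HarmonicSchwarzian

theorem mainTheorem8 (f h g : ℂ → ℂ)
    (hf : HarmonicSchwarzian.IsConvexHarmonicMapping f)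
    (hfhg : HarmonicSchwarzian.IsRepresentation f h g) :
    (∀ z ∈ Metric.ball (0 : ℂ) 1, HarmonicSchwarzian.jacobian h g z ≠ 0) ∧
      HarmonicSchwarzian.schwarzianNorm h g ≤ 6 := by
  obtain ⟨hh, hg, hfe⟩ := hfhg
  have heqOn : Set.EqOn f (fun z => h z + (starRingEnd ℂ) (g z)) (Metric.ball 0 1) := hfe
  have hinj : Set.InjOn (fun z => h z + (starRingEnd ℂ) (g z)) (Metric.ball 0 1) :=
    hf.univalent.congr heqOn
  have hconv : Convex ℝ ((fun z => h z + (starRingEnd ℂ) (g z)) '' Metric.ball 0 1) := by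
    rw [← heqOn.image_eq]
    exact hf.convex_image
  have hJ : ∀ z ∈ Metric.ball (0 : ℂ) 1, jacobian h g z ≠ 0 := fun z hz =>
    jacobian_ne_zero_of_injOn Metric.isOpen_ball hh hg hinj hz
  refine ⟨hJ, iSup₂_le fun z hz => ?_⟩
  have hkey : ‖schwarzian h g z‖ * (1 - ‖z‖ ^ 2) ^ 2 ≤ 6 := by
    rcases jacobian_pos_or_neg hh hg hJ with hpos | hneg
    · rw [schwarzian, if_pos (hpos z hz)]
      exact norm_sensePreservingSchwarzian_mul_le hh hg hinj hconv hpos hz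
    · rw [schwarzian, if_neg (hneg z hz).not_gt]
      -- Conjugation is an injective real linear map, so conj f is again univalent with convex
      -- image, and its Jacobian is positive.
      have hcomp : (fun z => g z + (starRingEnd ℂ) (h z)) =
          (starRingEnd ℂ) ∘ fun z => h z + (starRingEnd ℂ) (g z) := by
        funext w
        simp [add_comm]
      refine norm_sensePreservingSchwarzian_mul_le hg hh ?_ ?_ ?_ hz
      · rw [hcomp]
        exact (starRingEnd ℂ).injective.comp_injOn hinj
      · rw [hcomp, Set.image_comp]
        exact hconv.linear_image Complex.conjAe.toLinearMap
      · intro w hw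
        have := hneg w hw
        unfold jacobian at this ⊢
        linarith
  calc ENNReal.ofReal (‖schwarzian h g z‖ * (1 - ‖z‖ ^ 2) ^ 2) ≤ ENNReal.ofReal 6 :=
        ENNReal.ofReal_le_ofReal hkey
    _ = 6 := by norm_num
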